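/- Let $n\ge 1$, $C>0$ and $\rho>\tfrac14$. There is a constant $\lambda_0=\lambda_0(C,n,\rho)$ with the following property. Let $V\in L^\infty(\mathbb R\times\mathbb R^n;\mathbb C)$ and $W\in L^\infty(\mathbb R\times\mathbb R^n;\mathbb C\times\mathbb C^n)$ satisfy $$|V(t,x)|\le \frac{C}{(1+|x|^2)^{\rho}},\qquad |W(t,x)|\le \frac{C}{(1+|x|^2)^{\rho}}$$ for almost every $(t,x)\in\mathbb R\times\mathbb R^n$. Let $u:\mathbb R\times\mathbb R^n\to\mathbb C$ belong to $C^1(\mathbb R;H^1(\mathbb R^n))\cap H^2_{loc}(\mathbb R\times\mathbb R^n)$ and satisfy $$|(\partial_t^2+\Delta)u|\le |Vu|+|W\cdot(\partial_t,\nabla)u|\quad\text{a.e. in }\mathbb R^{n+1},$$ where $\Delta$ and $\nabla$ act in the variable $x$, derivatives are weak, and $W\cdot(\partial_t,\nabla)u=W^0\partial_tu+\sum_{j=1}^nW^j\partial_{x_j}u$. If $$\sup_{t\in\mathbb R}\int_{\mathbb R^n}e^{4\lambda|x|}|u(t,x)|^2\,dx<\infty$$ for some $\lambda>\lambda_0$,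 then $u\equiv0$. -/

import Mathlib

open MeasureTheory
open scoped ENNReal ContDiff

noncomputable section

namespace Waveguide

/-- The space `ℝⁿ` of the variable `x`, with its Euclidean norm. -/
abbrev Space (n : ℕ) : Type := EuclideanSpace ℝ (Fin n)

/-- The space-time `ℝ × ℝⁿ` of the variable `(t, x)`; its volume is the product Lebesgue measure. -/
abbrev SpaceTime (n : ℕ) : Type := ℝ × Space n

section WeakDerivatives

variable {F : Type*} [NormedAddCommGroup F] [NormedSpace ℝ F] [MeasureSpace F]

/-- `g` is the weak derivative of `f` in the direction `v`, tested against all smooth compactly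
supported functions. -/
structure HasWeakDeriv (v : F) (f g : F → ℂ) : Prop where
  locallyIntegrable : LocallyIntegrable f volume
  locallyIntegrable_deriv : LocallyIntegrable g volume
  integral_eq : ∀ φ : F → ℝ, ContDiff ℝ ∞ φ → HasCompactSupport φ →
    ∫ x, (fderiv ℝ φ x v) • f x = -∫ x, φ x • g x

open Classical in
/-- The weak derivative of `f` in the direction `v` (unique up to null sets), and `0` if there is
none. -/
def weakDeriv (v : F) (f : F → ℂ) : F → ℂ :=
  if h : ∃ g, HasWeakDeriv v f g then h.choose else 0

/-- `f ∈ L²_loc`. -/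
def MemL2loc (f : F → ℂ) : Prop :=
  ∀ K : Set F, IsCompact K → MemLp f 2 (volume.restrict K)

/-- `f ∈ H^k_loc`: `f` and all its weak derivatives of order at most `k` are in `L²_loc`. -/
def MemHloc : ℕ → (F → ℂ) → Prop
  | 0, f => MemL2loc f
  | k + 1, f => MemL2loc f ∧ ∀ v : F, ∃ g, HasWeakDeriv v f g ∧ MemHloc k g

theorem HasWeakDeriv.congr {v : F} {f f' g g' : F → ℂ} (h : HasWeakDeriv v f g)
    (hf : f' =ᵐ[volume] f) (hg : g' =ᵐ[volume] g) : HasWeakDeriv v f' g' where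
  locallyIntegrable := h.locallyIntegrable.congr hf.symm
  locallyIntegrable_deriv := h.locallyIntegrable_deriv.congr hg.symm
  integral_eq φ hφ hc := by
    have h1 : ∫ x, (fderiv ℝ φ x v) • f' x = ∫ x, (fderiv ℝ φ x v) • f x :=
      integral_congr_ae (by filter_upwards [hf] with x hx; rw [hx])
    have h2 : ∫ x, φ x • g' x = ∫ x, φ x • g x :=
      integral_congr_ae (by filter_upwards [hg] with x hx; rw [hx])
    rw [h1, h2]
    exact h.integral_eq φ hφ hc

theorem HasWeakDeriv.zero (v : F) : HasWeakDeriv v (0 : F → ℂ) 0 where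
  locallyIntegrable := locallyIntegrable_zero
  locallyIntegrable_deriv := locallyIntegrable_zero
  integral_eq φ _ _ := by simp

theorem HasWeakDeriv.const_smul {v : F} {f g : F → ℂ} (h : HasWeakDeriv v f g) (c : ℂ) :
    HasWeakDeriv v (c • f) (c • g) where
  locallyIntegrable := h.locallyIntegrable.smul c
  locallyIntegrable_deriv := h.locallyIntegrable_deriv.smul c
  integral_eq φ hφ hc := by
    simp only [Pi.smul_apply, smul_comm _ c, integral_smul]
    rw [h.integral_eq φ hφ hc, smul_neg]

theorem HasWeakDeriv.add [OpensMeasurableSpace F] {v : F} {f g f' g' : F → ℂ}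
    (h : HasWeakDeriv v f g) (h' : HasWeakDeriv v f' g') :
    HasWeakDeriv v (f + f') (g + g') where
  locallyIntegrable := h.locallyIntegrable.add h'.locallyIntegrable
  locallyIntegrable_deriv := h.locallyIntegrable_deriv.add h'.locallyIntegrable_deriv
  integral_eq φ hφ hc := by
    have hd : Continuous fun x => fderiv ℝ φ x v :=
      (hφ.continuous_fderiv (by simp)).clm_apply continuous_const
    have hdc : HasCompactSupport fun x => fderiv ℝ φ x v := hc.fderiv_apply (𝕜 := ℝ) v
    simp only [Pi.add_apply, smul_add]
    rw [integral_add (h.locallyIntegrable.integrable_smul_left_of_hasCompactSupport hd hdc)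
        (h'.locallyIntegrable.integrable_smul_left_of_hasCompactSupport hd hdc),
      integral_add (h.locallyIntegrable_deriv.integrable_smul_left_of_hasCompactSupport
        hφ.continuous hc)
        (h'.locallyIntegrable_deriv.integrable_smul_left_of_hasCompactSupport hφ.continuous hc),
      h.integral_eq φ hφ hc, h'.integral_eq φ hφ hc, neg_add]

end WeakDerivatives

/-- `L²(ℝⁿ; ℂ)`. -/
abbrev L2 (n : ℕ) : Type := Lp ℂ 2 (volume : Measure (Space n))

/-- The Hilbert space `H¹(ℝⁿ; ℂ)`, realized as the space of pairs `(f, ∇f)` of an `L²` function and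
its weak gradient, when the latter is in `L²`. The inherited norm is the usual one,
`‖f‖² = ‖f‖²_{L²} + ∑ⱼ ‖∂ⱼf‖²_{L²}`. -/
def H1 (n : ℕ) : Submodule ℂ (WithLp 2 (L2 n × PiLp 2 (fun (_ : Fin n) => L2 n))) where
  carrier := {p | ∀ j, HasWeakDeriv (EuclideanSpace.single j (1 : ℝ)) p.fst (p.snd j)}
  zero_mem' _ := (HasWeakDeriv.zero _).congr (Lp.coeFn_zero ..) (Lp.coeFn_zero ..)
  add_mem' hp hq j := ((hp j).add (hq j)).congr (Lp.coeFn_add ..) (Lp.coeFn_add ..)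
  smul_mem' c _ hp j := ((hp j).const_smul c).congr (Lp.coeFn_smul ..) (Lp.coeFn_smul ..)

/-- The function underlying an element of `H¹`. -/
def H1.toFun {n : ℕ} (p : H1 n) : Space n → ℂ := (p.1.fst : L2 n)

/-- `u ∈ C¹(ℝ; H¹(ℝⁿ))`: the slices `u(t, ·)` are given by a continuously differentiable curve in
the Hilbert space `H¹(ℝⁿ)`. -/
def IsC1H1 {n : ℕ} (u : SpaceTime n → ℂ) : Prop :=
  ∃ U : ℝ → H1 n, ContDiff ℝ 1 U ∧ ∀ t, (fun x => u (t, x)) =ᵐ[volume] H1.toFun (U t)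

/-- The direction of `∂_t`. -/
def dirT (n : ℕ) : SpaceTime n := (1, 0)

/-- The direction of `∂_{x_j}`. -/
def dirX {n : ℕ} (j : Fin n) : SpaceTime n := (0, EuclideanSpace.single j 1)

/-- `(∂_t² + Δ) u`, with weak derivatives. -/
def laplaceTX {n : ℕ} (u : SpaceTime n → ℂ) (z : SpaceTime n) : ℂ :=
  weakDeriv (dirT n) (weakDeriv (dirT n) u) z + ∑ j, weakDeriv (dirX j) (weakDeriv (dirX j) u) z

/-- The values `ℂ × ℂⁿ` of `W`, with the Euclidean norm. -/
abbrev Covec (n : ℕ) : Type := WithLp 2 (ℂ × EuclideanSpace ℂ (Fin n))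

/-- `W · (∂_t, ∇) u`, with weak derivatives; the dot is bilinear. -/
def firstOrder {n : ℕ} (W : SpaceTime n → Covec n) (u : SpaceTime n → ℂ) (z : SpaceTime n) : ℂ :=
  (W z).fst * weakDeriv (dirT n) u z + ∑ j, (W z).snd j * weakDeriv (dirX j) u z

end Waveguide

end

/-!
The operator is conjugated with `e^φ`, where `φ` depends on a single coordinate `x_j` and
`φ' = μ q` with `1 ≤ q` and `q'(r) = (1 + r²)^(-2ρ)`. Since `4ρ > 1`, the function `q'` is
integrable, so `q` is bounded and `φ` grows at most linearly: for `μ` a fixed multiple of `λ`,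
`e^{2φ} ≤ e^{4λ|x|}`, and the hypothesis bounds the weighted mass of `u` in a ball of radius `R` by
`O(R)`. On the other hand `φ'' = μ (1 + r²)^(-2ρ)`, so the commutator term of the Carleman
inequality, which carries the weight `φ''` both on `u` and on its first derivatives, dominates the
squares of the potentials once `μ` is large. A cutoff at scale `R` contributes an error
`O(R⁻²)` times the weighted mass of `u` and its first derivatives; the latter is controlled by the
former (Caccioppoli), so the error is `O(R⁻¹)` and `∫ q' e^{2φ} |u|² = 0` in the limit.
-/

noncomputable section

namespace Waveguide

open Filter Topology ContinuousLinearMap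
open scoped Convolution InnerProductSpace

theorem eLpNorm_two_sq {α : Type*} [MeasurableSpace α] {G : Type*} [NormedAddCommGroup G]
    (f : α → G) (μ : Measure α) : eLpNorm f 2 μ ^ 2 = ∫⁻ x, ‖f x‖ₑ ^ 2 ∂μ := by
  have h := eLpNorm_nnreal_pow_eq_lintegral (f := f) (μ := μ) (p := 2) (by norm_num)
  simpa using h

theorem enorm_integral_smul_sq_le {α : Type*} [MeasurableSpace α] {G : Type*}
    [NormedAddCommGroup G] [NormedSpace ℝ G] {μ : Measure α} {ρ : α → ℝ}
    (hρ : Measurable ρ) (hρ0 : ∀ y, 0 ≤ ρ y) (hρ1 : ∫⁻ y, ENNReal.ofReal (ρ y) ∂μ = 1)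
    {h : α → G} (hh : AEStronglyMeasurable h μ) :
    ‖∫ y, ρ y • h y ∂μ‖ₑ ^ 2 ≤ ∫⁻ y, ENNReal.ofReal (ρ y) * ‖h y‖ₑ ^ 2 ∂μ := by
  set ν := μ.withDensity fun y => ENNReal.ofReal (ρ y)
  have hm : Measurable fun y => ENNReal.ofReal (ρ y) := by fun_prop
  have : IsProbabilityMeasure ν := ⟨by simp [ν, hρ1]⟩
  have hν : AEStronglyMeasurable h ν := hh.mono_ac (withDensity_absolutelyContinuous _ _)
  have hmean : ∫ y, ρ y • h y ∂μ = ∫ y, h y ∂ν := by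
    rw [integral_withDensity_eq_integral_toReal_smul hm (by simp)]
    exact integral_congr_ae (Eventually.of_forall fun y => by simp [hρ0])
  have hsq : ∫⁻ y, ENNReal.ofReal (ρ y) * ‖h y‖ₑ ^ 2 ∂μ = ∫⁻ y, ‖h y‖ₑ ^ 2 ∂ν := by
    rw [lintegral_withDensity_eq_lintegral_mul₀' hm.aemeasurable (by fun_prop)]
    rfl
  rw [hmean, hsq, ← eLpNorm_two_sq]
  gcongr
  refine (enorm_integral_le_lintegral_enorm _).trans ?_
  rw [← eLpNorm_one_eq_lintegral_enorm]
  exact eLpNorm_le_eLpNorm_of_exponent_le (by norm_num) hν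

theorem tendsto_eLpNorm_translate_sub {E G : Type*} [NormedAddCommGroup E]
    [NormedSpace ℝ E] [FiniteDimensional ℝ E] [MeasureSpace E] [BorelSpace E]
    [(volume : Measure E).IsAddHaarMeasure] [NormedAddCommGroup G]
    {p : ℝ≥0∞} [Fact (1 ≤ p)] (hp : p ≠ ⊤) {f : E → G}
    (hf : MemLp f p volume) :
    Tendsto (fun y : E => eLpNorm (fun x => f (x - y) - f x) p volume) (𝓝 0) (𝓝 0) := by
  let g : E → C(E, E) := fun y => ⟨fun x => x - y, by fun_prop⟩
  have hg : Continuous g := ContinuousMap.continuous_of_continuous_uncurry _ (by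
    change Continuous fun p : E × E => p.2 - p.1
    fun_prop)
  have hgm : ∀ y, MeasurePreserving (g y) (volume : Measure E) volume := fun y =>
    measurePreserving_sub_right volume y
  have hc : Continuous fun y => Lp.compMeasurePreserving (g y) (hgm y) (hf.toLp f) :=
    continuous_const.compMeasurePreservingLp hg hgm hp
  have h0 : Lp.compMeasurePreserving (g 0) (hgm 0) (hf.toLp f) = hf.toLp f := by
    rw [Lp.toLp_compMeasurePreserving]
    refine (MemLp.toLp_eq_toLp_iff _ _).2 (Eventually.of_forall fun x => ?_)
    simp [g]
  have ht := hc.tendsto 0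
  rw [h0, tendsto_iff_edist_tendsto_0] at ht
  refine ht.congr fun y => ?_
  rw [Lp.toLp_compMeasurePreserving, Lp.edist_toLp_toLp]
  rfl

theorem MemL2loc.locallyIntegrable {E : Type*} [NormedAddCommGroup E] [NormedSpace ℝ E]
    [LocallyCompactSpace E] [MeasureSpace E] [IsFiniteMeasureOnCompacts (volume : Measure E)]
    {f : E → ℂ} (hf : MemL2loc f) :
    LocallyIntegrable f volume := by
  rw [locallyIntegrable_iff]
  intro K hK
  have : IsFiniteMeasure ((volume : Measure E).restrict K) := ⟨by simpa using hK.measure_lt_top⟩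
  exact (hf K hK).integrable (by norm_num)

theorem fderiv_comp_sub_left {E : Type*} [NormedAddCommGroup E] [NormedSpace ℝ E]
    {ρ : E → ℝ} (hρ : Differentiable ℝ ρ) (x y v : E) :
    fderiv ℝ (fun z => ρ (x - z)) y v = -fderiv ℝ ρ (x - y) v := by
  have h := (hρ (x - y)).hasFDerivAt.comp y ((hasFDerivAt_id y).const_sub x)
  rw [show (fun z => ρ (x - z)) = ρ ∘ fun z => x - z from rfl]
  simp [h.fderiv]

section Mollification

variable {E : Type*} [NormedAddCommGroup E] [NormedSpace ℝ E] [FiniteDimensional ℝ E]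
  [MeasureSpace E]
  {G : Type*} [NormedAddCommGroup G] [NormedSpace ℝ G]

/-- The mollification of `f`: its convolution with the bump function `φ` normalized to integral
one. -/
def mollify (φ : ContDiffBump (0 : E)) (f : E → G) : E → G :=
  φ.normed volume ⋆[lsmul ℝ ℝ, volume] f

theorem mollify_apply (φ : ContDiffBump (0 : E)) (f : E → G) (x : E) :
    mollify φ f x = ∫ y, φ.normed volume y • f (x - y) := rfl

variable [BorelSpace E] [(volume : Measure E).IsAddHaarMeasure]

theorem tendsto_setLIntegral_translate_sub {f : E → ℂ} (hf : MemL2loc f) {K : Set E}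
    (hK : IsCompact K) :
    Tendsto (fun y : E => ∫⁻ x in K, ‖f (x - y) - f x‖ₑ ^ 2) (𝓝 0) (𝓝 0) := by
  set K' := Metric.cthickening 1 K
  have hK' : IsCompact K' := hK.cthickening
  have hF : MemLp (K'.indicator f) 2 volume :=
    (memLp_indicator_iff_restrict hK'.measurableSet).2 (hf K' hK')
  have : Fact ((1 : ℝ≥0∞) ≤ 2) := ⟨by norm_num⟩
  have htrunc : Tendsto (fun y : E => eLpNorm (fun x => K'.indicator f (x - y) - K'.indicator f x) 2
      volume ^ 2) (𝓝 0) (𝓝 0) := by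
    have := (ENNReal.continuous_pow 2).continuousAt.tendsto.comp
      (tendsto_eLpNorm_translate_sub (by norm_num) hF)
    simpa using! this
  refine tendsto_of_tendsto_of_tendsto_of_le_of_le' tendsto_const_nhds htrunc
    (Eventually.of_forall fun _ => zero_le) ?_
  filter_upwards [Metric.closedBall_mem_nhds (0 : E) one_pos] with y hy
  rw [eLpNorm_two_sq]
  refine le_trans (le_of_eq ?_) (setLIntegral_le_lintegral K _)
  refine setLIntegral_congr_fun hK.measurableSet fun x hx => ?_
  have hx' : x ∈ K' := Metric.self_subset_cthickening K hx
  have hxy : x - y ∈ K' := by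
    refine Metric.mem_cthickening_of_dist_le _ x _ _ hx ?_
    simpa [dist_eq_norm] using hy
  simp [hx', hxy]

theorem contDiff_mollify (φ : ContDiffBump (0 : E)) {f : E → G}
    (hf : LocallyIntegrable f volume) : ContDiff ℝ ∞ (mollify φ f) :=
  φ.hasCompactSupport_normed.contDiff_convolution_left _ φ.contDiff_normed hf

theorem mollify_sub_apply (φ : ContDiffBump (0 : E)) [CompleteSpace G] {f : E → G}
    (hf : LocallyIntegrable f volume) (x : E) :
    mollify φ f x - f x = ∫ y, φ.normed volume y • (f (x - y) - f x) := by
  have hi : Integrable (fun y => φ.normed volume y • f (x - y)) volume :=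
    (φ.hasCompactSupport_normed.convolutionExists_left (lsmul ℝ ℝ) φ.continuous_normed hf x)
  simp_rw [smul_sub]
  rw [integral_sub hi (φ.integrable_normed.smul_const _), φ.integral_normed_smul, mollify_apply]

theorem lintegral_normed (φ : ContDiffBump (0 : E)) :
    ∫⁻ y, ENNReal.ofReal (φ.normed volume y) = 1 := by
  rw [← ofReal_integral_eq_lintegral_ofReal φ.integrable_normed
    (Eventually.of_forall φ.nonneg_normed), φ.integral_normed, ENNReal.ofReal_one]

theorem setLIntegral_mollify_sub_le (φ : ContDiffBump (0 : E)) [CompleteSpace G] {f : E → G}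
    (hf : LocallyIntegrable f volume) (K : Set E) {ε : ℝ≥0∞}
    (h : ∀ y ∈ Metric.ball (0 : E) φ.rOut, ∫⁻ x in K, ‖f (x - y) - f x‖ₑ ^ 2 ≤ ε) :
    ∫⁻ x in K, ‖mollify φ f x - f x‖ₑ ^ 2 ≤ ε := by
  have hm := hf.aestronglyMeasurable
  have hmeas : AEMeasurable (fun p : E × E =>
      ENNReal.ofReal (φ.normed volume p.2) * ‖f (p.1 - p.2) - f p.1‖ₑ ^ 2)
      (((volume : Measure E).restrict K).prod volume) := by
    have hshift : AEStronglyMeasurable (fun p : E × E => f (p.1 - p.2)) (volume.prod volume) :=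
      hm.comp_quasiMeasurePreserving (quasiMeasurePreserving_sub volume volume)
    have hfst : AEStronglyMeasurable (fun p : E × E => f p.1) (volume.prod volume) := hm.comp_fst
    have hprod : AEMeasurable (fun p : E × E =>
        ENNReal.ofReal (φ.normed volume p.2) * ‖f (p.1 - p.2) - f p.1‖ₑ ^ 2)
        ((volume : Measure E).prod volume) := by
      refine AEMeasurable.mul ?_ ((hshift.sub hfst).enorm.pow_const 2)
      exact (φ.continuous_normed.measurable.ennreal_ofReal.comp measurable_snd).aemeasurable
    exact hprod.mono_ac (Measure.restrict_le_self.absolutelyContinuous.prod .rfl)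
  calc ∫⁻ x in K, ‖mollify φ f x - f x‖ₑ ^ 2
      ≤ ∫⁻ x in K, ∫⁻ y, ENNReal.ofReal (φ.normed volume y) * ‖f (x - y) - f x‖ₑ ^ 2 := by
        refine lintegral_mono fun x => ?_
        simp only [mollify_sub_apply φ hf]
        exact enorm_integral_smul_sq_le φ.continuous_normed.measurable φ.nonneg_normed
          (lintegral_normed φ)
          ((hm.comp_quasiMeasurePreserving
            (quasiMeasurePreserving_sub_left volume x)).sub aestronglyMeasurable_const)
    _ = ∫⁻ y, ∫⁻ x in K, ENNReal.ofReal (φ.normed volume y) * ‖f (x - y) - f x‖ₑ ^ 2 :=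
        lintegral_lintegral_swap hmeas
    _ ≤ ∫⁻ y, ENNReal.ofReal (φ.normed volume y) * ε := by
        refine lintegral_mono fun y => ?_
        rw [lintegral_const_mul' _ _ ENNReal.ofReal_ne_top]
        by_cases hy : y ∈ Metric.ball (0 : E) φ.rOut
        · gcongr
          exact h y hy
        · have : φ.normed volume y = 0 := by
            rw [← φ.support_normed_eq (μ := volume)] at hy
            simpa using hy
          simp [this]
    _ = ε := by
        rw [lintegral_mul_const _ (by have := φ.continuous_normed (μ := volume); fun_prop),
          lintegral_normed, one_mul]

/-- Convergence of a sequence of functions in `L²_loc`: in `L²(K)` for every compact set `K`. -/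
def L2locTendsto (s : ℕ → E → G) (f : E → G) : Prop :=
  ∀ K : Set E, IsCompact K →
    Tendsto (fun k => eLpNorm (s k - f) 2 (volume.restrict K)) atTop (𝓝 0)

theorem l2locTendsto_mollify {φ : ℕ → ContDiffBump (0 : E)}
    (hφ : Tendsto (fun k => (φ k).rOut) atTop (𝓝 0)) {f : E → ℂ} (hf : MemL2loc f) :
    L2locTendsto (fun k => mollify (φ k) f) f := by
  intro K hK
  have hsq : Tendsto (fun k => ∫⁻ x in K, ‖mollify (φ k) f x - f x‖ₑ ^ 2) atTop (𝓝 0) := by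
    rw [ENNReal.tendsto_nhds_zero]
    intro ε hε
    obtain ⟨δ, hδ, hball⟩ := Metric.eventually_nhds_iff_ball.1
      (ENNReal.tendsto_nhds_zero.1 (tendsto_setLIntegral_translate_sub hf hK) ε hε)
    filter_upwards [hφ.eventually (gt_mem_nhds hδ)] with k hk
    exact setLIntegral_mollify_sub_le (φ k) hf.locallyIntegrable K fun y hy =>
      hball y (Metric.ball_subset_ball hk.le hy)
  have hsqrt := (ENNReal.continuous_rpow_const (y := 1 / 2)).continuousAt.tendsto.comp hsq
  simp only [Function.comp_def] at hsqrt
  rw [ENNReal.zero_rpow_of_pos (by norm_num)] at hsqrt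
  refine hsqrt.congr fun k => ?_
  have := eLpNorm_two_sq (mollify (φ k) f - f) (volume.restrict K)
  simp only [Pi.sub_apply] at this
  rw [← this, ← ENNReal.rpow_natCast, ← ENNReal.rpow_mul]
  norm_num

theorem fderiv_convolution_left_apply {ρ : E → ℝ} (hρ : ContDiff ℝ 1 ρ)
    (hρc : HasCompactSupport ρ) {f : E → G} (hf : LocallyIntegrable f volume) (x v : E) :
    fderiv ℝ (ρ ⋆[lsmul ℝ ℝ, volume] f) x v = ∫ y, fderiv ℝ ρ y v • f (x - y) := by
  have hex : ConvolutionExistsAt (fderiv ℝ ρ) f x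
      ((lsmul ℝ ℝ : ℝ →L[ℝ] G →L[ℝ] G).precompL E) volume :=
    (hρc.fderiv (𝕜 := ℝ)).convolutionExists_left _ (hρ.continuous_fderiv (by simp)) hf x
  rw [(hρc.hasFDerivAt_convolution_left (lsmul ℝ ℝ) hρ hf x).fderiv, convolution_def,
    ContinuousLinearMap.integral_apply hex]
  rfl

theorem fderiv_mollify (φ : ContDiffBump (0 : E)) {v : E} {f g : E → ℂ}
    (h : HasWeakDeriv v f g) (x : E) : fderiv ℝ (mollify φ f) x v = mollify φ g x := by
  have hφ : ContDiff ℝ ∞ (φ.normed volume) := φ.contDiff_normed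
  have htest := h.integral_eq (fun y => φ.normed volume (x - y))
    (hφ.comp (contDiff_const.sub contDiff_id))
    (φ.hasCompactSupport_normed.comp_homeomorph (Homeomorph.subLeft x))
  simp only [fderiv_comp_sub_left (hφ.differentiable (by simp)), neg_smul, integral_neg,
    neg_inj] at htest
  rw [mollify, fderiv_convolution_left_apply (hφ.of_le (by simp)) φ.hasCompactSupport_normed
      h.locallyIntegrable, mollify_apply, ← integral_sub_left_eq_self _ volume x,
    ← integral_sub_left_eq_self (fun y => φ.normed volume y • g (x - y)) volume x]
  simpa only [sub_sub_cancel] using htest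

end Mollification

section DirDeriv

variable {E : Type*} [NormedAddCommGroup E] [NormedSpace ℝ E]
  {F : Type*} [NormedAddCommGroup F] [NormedSpace ℝ F] {v : E}

/-- The directional derivative of `f` along the constant vector field `v`. -/
def dirDeriv (v : E) (f : E → F) : E → F :=
  fun x => fderiv ℝ f x v

theorem contDiff_dirDeriv {f : E → F} (hf : ContDiff ℝ ∞ f) : ContDiff ℝ ∞ (dirDeriv v f) :=
  (hf.fderiv_right (m := ∞) (by simp)).clm_apply contDiff_const

theorem tsupport_dirDeriv_subset {f : E → F} : tsupport (dirDeriv v f) ⊆ tsupport f :=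
  tsupport_fderiv_apply_subset ℝ v

theorem hasCompactSupport_dirDeriv {f : E → F} (hf : HasCompactSupport f) :
    HasCompactSupport (dirDeriv v f) :=
  hf.isCompact.of_isClosed_subset (isClosed_tsupport _) tsupport_dirDeriv_subset

theorem dirDeriv_zero : dirDeriv v (0 : E → F) = 0 := by
  ext x
  simp [dirDeriv]

theorem dirDeriv_add {f g : E → F} (hf : ContDiff ℝ ∞ f) (hg : ContDiff ℝ ∞ g) :
    dirDeriv v (fun x => f x + g x) = fun x => dirDeriv v f x + dirDeriv v g x := by
  ext x
  rw [dirDeriv, fderiv_fun_add (hf.differentiable (by simp) x) (hg.differentiable (by simp) x)]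
  rfl

theorem dirDeriv_smul {m : E → ℝ} {f : E → F} (hm : ContDiff ℝ ∞ m) (hf : ContDiff ℝ ∞ f) :
    dirDeriv v (fun x => m x • f x) = fun x => m x • dirDeriv v f x + dirDeriv v m x • f x := by
  ext x
  rw [dirDeriv, fderiv_fun_smul (hm.differentiable (by simp) x) (hf.differentiable (by simp) x)]
  rfl

theorem dirDeriv_comp_clm {p : ℝ → F} (hp : ContDiff ℝ ∞ p) (ℓ : E →L[ℝ] ℝ) :
    dirDeriv v (fun x => p (ℓ x)) = fun x => ℓ v • deriv p (ℓ x) := by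
  ext x
  have h := (hp.differentiable (by simp) (ℓ x)).hasFDerivAt.comp x ℓ.hasFDerivAt
  rw [dirDeriv, show (fun x => p (ℓ x)) = p ∘ ℓ from rfl, h.fderiv]
  simp [fderiv_eq_smul_deriv]

theorem dirDeriv_comm {w : E} {f : E → F} (hf : ContDiff ℝ ∞ f) :
    dirDeriv v (dirDeriv w f) = dirDeriv w (dirDeriv v f) := by
  ext x
  have hd : DifferentiableAt ℝ (fderiv ℝ f) x :=
    (hf.fderiv_right (m := ∞) (by simp)).differentiable (by simp) x
  have hsnd (v w : E) : dirDeriv v (dirDeriv w f) x = fderiv ℝ (fderiv ℝ f) x v w := by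
    change fderiv ℝ (fun y => fderiv ℝ f y w) x v = _
    rw [fderiv_clm_apply hd (differentiableAt_const w)]
    simp
  rw [hsnd, hsnd]
  exact (hf.contDiffAt.isSymmSndFDerivAt (by
    simpa using (WithTop.coe_le_coe.2 le_top : ((2 : ℕ∞) : WithTop ℕ∞) ≤ (⊤ : ℕ∞)))) v w

theorem dirDeriv_pow {m : E → ℝ} (hm : ContDiff ℝ ∞ m) (k : ℕ) :
    dirDeriv v (fun x => m x ^ k) = fun x => k * m x ^ (k - 1) * dirDeriv v m x := by
  ext x
  rw [dirDeriv, fderiv_fun_pow k (hm.differentiable (by simp) x)]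
  simp [dirDeriv]

variable {ι : Type*} [Fintype ι]

/-- The Laplacian `∑ᵢ ∂ᵢ² f` in the directions `e i`, which need not form a basis. -/
def laplaceAlong (e : ι → E) (f : E → F) (x : E) : F :=
  ∑ i, dirDeriv (e i) (dirDeriv (e i) f) x

/-- The squared length `∑ᵢ |∂ᵢ f|²` of the gradient in the directions `e i`. -/
def gradSqAlong (e : ι → E) (f : E → F) (x : E) : ℝ :=
  ∑ i, ‖dirDeriv (e i) f x‖ ^ 2

theorem gradSqAlong_nonneg (e : ι → E) (f : E → F) (x : E) : 0 ≤ gradSqAlong e f x :=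
  Finset.sum_nonneg fun _ _ => sq_nonneg _

theorem contDiff_laplaceAlong {e : ι → E} {f : E → F} (hf : ContDiff ℝ ∞ f) :
    ContDiff ℝ ∞ (laplaceAlong e f) :=
  ContDiff.sum fun _ _ => contDiff_dirDeriv (contDiff_dirDeriv hf)

theorem gradSqAlong_eq_zero_of_notMem_tsupport {e : ι → E} {f : E → F} {x : E}
    (hx : x ∉ tsupport f) : gradSqAlong e f x = 0 :=
  Finset.sum_eq_zero fun _ _ => by
    rw [image_eq_zero_of_notMem_tsupport fun h => hx (tsupport_dirDeriv_subset h), norm_zero,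
      zero_pow two_ne_zero]

theorem laplaceAlong_eq_zero_of_notMem_tsupport {e : ι → E} {f : E → F} {x : E}
    (hx : x ∉ tsupport f) : laplaceAlong e f x = 0 :=
  Finset.sum_eq_zero fun _ _ => image_eq_zero_of_notMem_tsupport fun h =>
    hx (tsupport_dirDeriv_subset (tsupport_dirDeriv_subset h))

theorem hasCompactSupport_laplaceAlong {e : ι → E} {f : E → F} (hf : HasCompactSupport f) :
    HasCompactSupport (laplaceAlong e f) :=
  .intro hf.isCompact fun _ => laplaceAlong_eq_zero_of_notMem_tsupport

end DirDeriv

section IntegralIdentities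

theorem integrable_mul_inner {E : Type*} [TopologicalSpace E] [MeasurableSpace E]
    [OpensMeasurableSpace E] {μ : Measure E} [IsFiniteMeasureOnCompacts μ] {F : Type*}
    [NormedAddCommGroup F] [InnerProductSpace ℝ F] {m : E → ℝ} {f g : E → F}
    (hm : Continuous m) (hf : Continuous f) (hg : Continuous g) (hc : HasCompactSupport f) :
    Integrable (fun x => m x * ⟪f x, g x⟫_ℝ) μ := by
  refine (hm.mul (hf.inner hg)).integrable_of_hasCompactSupport (hc.mono fun x hx hfx => hx ?_)
  simp [hfx]

theorem integrable_mul_sq_norm {E : Type*} [TopologicalSpace E] [MeasurableSpace E]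
    [OpensMeasurableSpace E] {μ : Measure E} [IsFiniteMeasureOnCompacts μ] {F : Type*}
    [NormedAddCommGroup F] [InnerProductSpace ℝ F] {m : E → ℝ} {f : E → F}
    (hm : Continuous m) (hf : Continuous f) (hc : HasCompactSupport f) :
    Integrable (fun x => m x * ‖f x‖ ^ 2) μ := by
  simpa only [real_inner_self_eq_norm_sq] using integrable_mul_inner hm hf hf hc

variable {E : Type*} [NormedAddCommGroup E] [NormedSpace ℝ E]
  [MeasurableSpace E] [BorelSpace E] {μ : Measure E}
  {F : Type*} [NormedAddCommGroup F] [InnerProductSpace ℝ F]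
  {ι : Type*} [Fintype ι] {e : ι → E} {i₀ : ι} {v : E} {m : E → ℝ} {f g : E → F}

theorem integrable_mul_gradSqAlong [IsFiniteMeasureOnCompacts μ] (hm : Continuous m)
    (hf : ContDiff ℝ ∞ f) (hc : HasCompactSupport f) :
    Integrable (fun x => m x * gradSqAlong e f x) μ := by
  simp only [gradSqAlong, Finset.mul_sum]
  exact integrable_finsetSum _ fun i _ => integrable_mul_sq_norm hm
    (contDiff_dirDeriv hf).continuous (hasCompactSupport_dirDeriv hc)

theorem integral_mul_gradSqAlong [IsFiniteMeasureOnCompacts μ] (hm : Continuous m)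
    (hf : ContDiff ℝ ∞ f) (hc : HasCompactSupport f) : ∫ x, m x * gradSqAlong e f x ∂μ =
      ∑ i, ∫ x, m x * ‖dirDeriv (e i) f x‖ ^ 2 ∂μ := by
  simp only [gradSqAlong, Finset.mul_sum]
  exact integral_finsetSum _ fun i _ => integrable_mul_sq_norm hm
    (contDiff_dirDeriv hf).continuous (hasCompactSupport_dirDeriv hc)

variable [FiniteDimensional ℝ E] [μ.IsAddHaarMeasure]

theorem integral_mul_inner_dirDeriv (hm : ContDiff ℝ ∞ m) (hf : ContDiff ℝ ∞ f)
    (hg : ContDiff ℝ ∞ g) (hc : HasCompactSupport f) :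
    ∫ x, m x * ⟪f x, dirDeriv v g x⟫_ℝ ∂μ =
      -(∫ x, m x * ⟪dirDeriv v f x, g x⟫_ℝ ∂μ) - ∫ x, dirDeriv v m x * ⟪f x, g x⟫_ℝ ∂μ := by
  have hfv := integrable_mul_inner (μ := μ) hm.continuous (contDiff_dirDeriv (v := v) hf).continuous
    hg.continuous (hasCompactSupport_dirDeriv hc)
  have hmv := integrable_mul_inner (μ := μ) (contDiff_dirDeriv (v := v) hm).continuous
    hf.continuous hg.continuous hc
  have hderiv (x : E) : ⟪dirDeriv v (fun x => m x • f x) x, g x⟫_ℝ =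
      m x * ⟪dirDeriv v f x, g x⟫_ℝ + dirDeriv v m x * ⟪f x, g x⟫_ℝ := by
    simp only [dirDeriv_smul hm hf, inner_add_left, real_inner_smul_left]
  have hprod {h : E → F} (hh : Continuous h) : Integrable (fun x => ⟪m x • f x, h x⟫_ℝ) μ := by
    simpa only [real_inner_smul_left] using
      integrable_mul_inner hm.continuous hf.continuous hh hc
  have hibp : ∫ x, ⟪m x • f x, dirDeriv v g x⟫_ℝ ∂μ =
      -∫ x, ⟪dirDeriv v (fun x => m x • f x) x, g x⟫_ℝ ∂μ :=
    integral_bilinear_fderiv_right_eq_neg_left_of_integrable (B := innerSL ℝ)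
      ((hfv.add hmv).congr (Eventually.of_forall fun x => (hderiv x).symm))
      (hprod (contDiff_dirDeriv hg).continuous) (hprod hg.continuous)
      (fun x _ => (hm.smul hf).differentiable (by simp) x)
      (fun x _ => hg.differentiable (by simp) x)
  rw [← neg_add', ← integral_add hfv hmv]
  simpa only [hderiv, real_inner_smul_left] using hibp

theorem integral_mul_inner_dirDeriv_self (hm : ContDiff ℝ ∞ m) (hf : ContDiff ℝ ∞ f)
    (hc : HasCompactSupport f) :
    ∫ x, m x * ⟪f x, dirDeriv v f x⟫_ℝ ∂μ = -(1 / 2) * ∫ x, dirDeriv v m x * ‖f x‖ ^ 2 ∂μ := by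
  have h := integral_mul_inner_dirDeriv (μ := μ) (v := v) hm hf hf hc
  simp only [real_inner_comm (f _) (dirDeriv v f _), real_inner_self_eq_norm_sq] at h
  linarith

theorem integral_mul_inner_laplaceAlong (hm : ContDiff ℝ ∞ m)
    (hm₀ : ∀ i ≠ i₀, dirDeriv (e i) m = 0) (hf : ContDiff ℝ ∞ f) (hg : ContDiff ℝ ∞ g)
    (hc : HasCompactSupport f) :
    ∫ x, m x * ⟪f x, laplaceAlong e g x⟫_ℝ ∂μ =
      -(∑ i, ∫ x, m x * ⟪dirDeriv (e i) f x, dirDeriv (e i) g x⟫_ℝ ∂μ) -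
        ∫ x, dirDeriv (e i₀) m x * ⟪f x, dirDeriv (e i₀) g x⟫_ℝ ∂μ := by
  have hibp (i : ι) := integral_mul_inner_dirDeriv (μ := μ) (v := e i) hm hf
    (contDiff_dirDeriv (v := e i) hg) hc
  simp only [laplaceAlong, inner_sum, Finset.mul_sum]
  rw [integral_finsetSum _ fun i _ => integrable_mul_inner hm.continuous hf.continuous
    (contDiff_dirDeriv (contDiff_dirDeriv hg)).continuous hc]
  simp only [hibp, Finset.sum_sub_distrib, Finset.sum_neg_distrib]
  congr 1
  exact Finset.sum_eq_single i₀ (fun i _ hi => by simp [hm₀ i hi]) (by simp)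

theorem integral_mul_inner_laplaceAlong_self (hm : ContDiff ℝ ∞ m)
    (hm₀ : ∀ i ≠ i₀, dirDeriv (e i) m = 0) (hf : ContDiff ℝ ∞ f) (hc : HasCompactSupport f) :
    ∫ x, m x * ⟪f x, laplaceAlong e f x⟫_ℝ ∂μ = -(∫ x, m x * gradSqAlong e f x ∂μ) +
      1 / 2 * ∫ x, dirDeriv (e i₀) (dirDeriv (e i₀) m) x * ‖f x‖ ^ 2 ∂μ := by
  rw [integral_mul_inner_laplaceAlong hm hm₀ hf hf hc,
    integral_mul_inner_dirDeriv_self (contDiff_dirDeriv hm) hf hc,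
    integral_mul_gradSqAlong hm.continuous hf hc]
  simp only [real_inner_self_eq_norm_sq]
  ring

theorem integral_mul_inner_dirDeriv_laplaceAlong (hm : ContDiff ℝ ∞ m)
    (hm₀ : ∀ i ≠ i₀, dirDeriv (e i) m = 0) (hf : ContDiff ℝ ∞ f) (hc : HasCompactSupport f) :
    ∫ x, m x * ⟪dirDeriv (e i₀) f x, laplaceAlong e f x⟫_ℝ ∂μ =
      1 / 2 * (∫ x, dirDeriv (e i₀) m x * gradSqAlong e f x ∂μ) -
        ∫ x, dirDeriv (e i₀) m x * ‖dirDeriv (e i₀) f x‖ ^ 2 ∂μ := by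
  have hcomm (i : ι) : ∫ x, m x *
        ⟪dirDeriv (e i) (dirDeriv (e i₀) f) x, dirDeriv (e i) f x⟫_ℝ ∂μ =
      -(1 / 2) * ∫ x, dirDeriv (e i₀) m x * ‖dirDeriv (e i) f x‖ ^ 2 ∂μ := by
    rw [← integral_mul_inner_dirDeriv_self hm (contDiff_dirDeriv hf)
      (hasCompactSupport_dirDeriv hc), dirDeriv_comm hf]
    simp only [real_inner_comm]
  rw [integral_mul_inner_laplaceAlong hm hm₀ (contDiff_dirDeriv hf) hf
      (hasCompactSupport_dirDeriv hc),
    integral_mul_gradSqAlong (contDiff_dirDeriv hm).continuous hf hc]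
  simp only [hcomm, real_inner_self_eq_norm_sq, ← Finset.mul_sum]
  ring

end IntegralIdentities

section Conjugation

variable {E : Type*} [NormedAddCommGroup E] [NormedSpace ℝ E] {F : Type*} [NormedAddCommGroup F]
  [InnerProductSpace ℝ F] {ι : Type*} [Fintype ι] {e : ι → E} {i₀ : ι} {P : E → ℝ} {f : E → F}

/-- The conjugated Laplacian `e^Φ Δ (e^{-Φ} f)`, in terms of the slope `P = ∂Φ` of a weight `Φ`
which varies only along `e i₀`. -/
def conjLaplaceAlong (e : ι → E) (i₀ : ι) (P : E → ℝ) (f : E → F) (x : E) : F :=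
  laplaceAlong e f x - (2 * P x) • dirDeriv (e i₀) f x + (P x ^ 2 - dirDeriv (e i₀) P x) • f x

/-- A lower bound for `‖conjLaplaceAlong e i₀ P f‖ ^ 2` whose integral is computed by parts. -/
def conjCrossTerms (e : ι → E) (i₀ : ι) (P : E → ℝ) (f : E → F) (x : E) : ℝ :=
  -4 * (P x * ⟪dirDeriv (e i₀) f x, laplaceAlong e f x⟫_ℝ) +
    -4 * (dirDeriv (e i₀) P x * ⟪f x, laplaceAlong e f x⟫_ℝ) +
    -4 * (P x ^ 3 * ⟪f x, dirDeriv (e i₀) f x⟫_ℝ) -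
    (4 * P x ^ 2 * dirDeriv (e i₀) P x + dirDeriv (e i₀) P x ^ 2) * ‖f x‖ ^ 2

theorem conjCrossTerms_le_sq_norm (x : E) :
    conjCrossTerms e i₀ P f x ≤ ‖conjLaplaceAlong e i₀ P f x‖ ^ 2 := by
  suffices hdiff : ‖conjLaplaceAlong e i₀ P f x‖ ^ 2 = conjCrossTerms e i₀ P f x +
      (‖laplaceAlong e f x + (P x ^ 2 + dirDeriv (e i₀) P x) • f x‖ ^ 2 +
        ‖(2 * P x) • dirDeriv (e i₀) f x + dirDeriv (e i₀) P x • f x‖ ^ 2) by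
    rw [hdiff]
    exact le_add_of_nonneg_right (by positivity)
  simp only [conjLaplaceAlong, conjCrossTerms, ← real_inner_self_eq_norm_sq, inner_add_left,
    inner_add_right, inner_sub_left, inner_sub_right, real_inner_smul_left, real_inner_smul_right,
    real_inner_comm (dirDeriv (e i₀) f x) (f x), real_inner_comm (laplaceAlong e f x) (f x),
    real_inner_comm (laplaceAlong e f x) (dirDeriv (e i₀) f x)]
  ring

variable [MeasurableSpace E] [BorelSpace E] {μ : Measure E}

theorem integrable_sq_norm_conjLaplaceAlong [IsFiniteMeasureOnCompacts μ] (hP : ContDiff ℝ ∞ P)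
    (hf : ContDiff ℝ ∞ f) (hc : HasCompactSupport f) :
    Integrable (fun x => ‖conjLaplaceAlong e i₀ P f x‖ ^ 2) μ := by
  have hconj : ContDiff ℝ ∞ (conjLaplaceAlong e i₀ P f) :=
    ((contDiff_laplaceAlong hf).sub ((contDiff_const.mul hP).smul (contDiff_dirDeriv hf))).add
      (((hP.pow 2).sub (contDiff_dirDeriv hP)).smul hf)
  have hconjc : HasCompactSupport (conjLaplaceAlong e i₀ P f) :=
    ((hasCompactSupport_laplaceAlong hc).sub (hasCompactSupport_dirDeriv hc).smul_left).add
      hc.smul_left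
  simpa using integrable_mul_sq_norm (m := 1) continuous_one hconj.continuous hconjc

theorem integrable_conjCrossTerms [IsFiniteMeasureOnCompacts μ] (hP : ContDiff ℝ ∞ P)
    (hf : ContDiff ℝ ∞ f) (hc : HasCompactSupport f) :
    Integrable (conjCrossTerms e i₀ P f) μ := by
  have hcP := hP.continuous
  have hcD := (contDiff_dirDeriv (v := e i₀) hP).continuous
  have hcA := (contDiff_laplaceAlong (e := e) hf).continuous
  have hcS := (contDiff_dirDeriv (v := e i₀) hf).continuous
  exact ((((integrable_mul_inner hcP hcS hcA (hasCompactSupport_dirDeriv hc)).const_mul _).add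
    ((integrable_mul_inner hcD hf.continuous hcA hc).const_mul _)).add
    ((integrable_mul_inner (hcP.fun_pow 3) hf.continuous hcS hc).const_mul _)).sub
    (integrable_mul_sq_norm (by fun_prop) hf.continuous hc)

variable [FiniteDimensional ℝ E] [μ.IsAddHaarMeasure]

theorem integral_conjCrossTerms (hP : ContDiff ℝ ∞ P)
    (hP₀ : ∀ i ≠ i₀, dirDeriv (e i) P = 0) (hf : ContDiff ℝ ∞ f) (hc : HasCompactSupport f) :
    ∫ x, conjCrossTerms e i₀ P f x ∂μ =
      (∫ x, (2 * (dirDeriv (e i₀) P x * gradSqAlong e f x) +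
        (2 * P x ^ 2 * dirDeriv (e i₀) P x - 2 * dirDeriv (e i₀) (dirDeriv (e i₀)
          (dirDeriv (e i₀) P)) x - dirDeriv (e i₀) P x ^ 2) * ‖f x‖ ^ 2) ∂μ) +
      4 * ∫ x, dirDeriv (e i₀) P x * ‖dirDeriv (e i₀) f x‖ ^ 2 ∂μ := by
  unfold conjCrossTerms
  have hD : ContDiff ℝ ∞ (dirDeriv (e i₀) P) := contDiff_dirDeriv hP
  have hD₀ (i : ι) (hi : i ≠ i₀) : dirDeriv (e i) (dirDeriv (e i₀) P) = 0 := by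
    rw [dirDeriv_comm hP, hP₀ i hi, dirDeriv_zero]
  have hcD₃ := (contDiff_dirDeriv (v := e i₀) (contDiff_dirDeriv (v := e i₀) hD)).continuous
  have hSA := integral_mul_inner_dirDeriv_laplaceAlong (μ := μ) hP hP₀ hf hc
  have hfA := integral_mul_inner_laplaceAlong_self (μ := μ) hD hD₀ hf hc
  have hfS : ∫ x, P x ^ 3 * ⟪f x, dirDeriv (e i₀) f x⟫_ℝ ∂μ =
      -(1 / 2) * ∫ x, 3 * P x ^ 2 * dirDeriv (e i₀) P x * ‖f x‖ ^ 2 ∂μ := by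
    simpa [dirDeriv_pow hP] using
      integral_mul_inner_dirDeriv_self (μ := μ) (v := e i₀) (hP.pow 3) hf hc
  set S := dirDeriv (e i₀) f
  set D := dirDeriv (e i₀) P
  set D₃ := dirDeriv (e i₀) (dirDeriv (e i₀) D)
  have hcP := hP.continuous
  have hcD := hD.continuous
  have hcA := (contDiff_laplaceAlong (e := e) hf).continuous
  have hcS : Continuous S := (contDiff_dirDeriv hf).continuous
  have hiSA := (integrable_mul_inner (μ := μ) hcP hcS hcA
    (hasCompactSupport_dirDeriv hc)).const_mul (-4)
  have hifA := (integrable_mul_inner (μ := μ) hcD hf.continuous hcA hc).const_mul (-4)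
  have hifS := (integrable_mul_inner (μ := μ) (hcP.fun_pow 3) hf.continuous hcS hc).const_mul (-4)
  have hiG := (integrable_mul_gradSqAlong (μ := μ) (e := e) hcD hf hc).const_mul 2
  have hisq {m : E → ℝ} (hm : Continuous m) : Integrable (fun x => m x * ‖f x‖ ^ 2) μ :=
    integrable_mul_sq_norm hm hf.continuous hc
  have hzeroth : ∫ x, (4 * P x ^ 2 * D x + D x ^ 2) * ‖f x‖ ^ 2 ∂μ +
      ∫ x, (2 * P x ^ 2 * D x - 2 * D₃ x - D x ^ 2) * ‖f x‖ ^ 2 ∂μ =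
      2 * (∫ x, 3 * P x ^ 2 * D x * ‖f x‖ ^ 2 ∂μ) -
        2 * ∫ x, D₃ x * ‖f x‖ ^ 2 ∂μ := by
    rw [← integral_const_mul, ← integral_const_mul,
      ← integral_add (hisq (by fun_prop)) (hisq (by fun_prop)),
      ← integral_sub ((hisq (by fun_prop)).const_mul 2) ((hisq (by fun_prop)).const_mul 2)]
    congr with x
    ring
  rw [integral_sub ((hiSA.fun_add hifA).fun_add hifS) (hisq (by fun_prop)),
    integral_add (hiSA.fun_add hifA) hifS, integral_add hiSA hifA,
    integral_add hiG (hisq (by fun_prop))]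
  simp only [integral_const_mul]
  linarith

theorem carleman_conjugated (hP : ContDiff ℝ ∞ P)
    (hP₀ : ∀ i ≠ i₀, dirDeriv (e i) P = 0) (hP' : ∀ x, 0 ≤ dirDeriv (e i₀) P x)
    (hf : ContDiff ℝ ∞ f) (hc : HasCompactSupport f) :
    ∫ x, (2 * (dirDeriv (e i₀) P x * gradSqAlong e f x) +
        (2 * P x ^ 2 * dirDeriv (e i₀) P x - 2 * dirDeriv (e i₀) (dirDeriv (e i₀)
          (dirDeriv (e i₀) P)) x - dirDeriv (e i₀) P x ^ 2) * ‖f x‖ ^ 2) ∂μ ≤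
      ∫ x, ‖conjLaplaceAlong e i₀ P f x‖ ^ 2 ∂μ := by
  refine le_trans ?_ (integral_mono (integrable_conjCrossTerms hP hf hc)
    (integrable_sq_norm_conjLaplaceAlong hP hf hc) conjCrossTerms_le_sq_norm)
  rw [integral_conjCrossTerms hP hP₀ hf hc]
  exact le_add_of_nonneg_right (mul_nonneg (by norm_num) (integral_nonneg fun x =>
    mul_nonneg (hP' x) (sq_nonneg _)))

end Conjugation

/-- A weight `exp φ` on the line, with slope `φ' = lam * q` of variable size `lam`, for which the
Carleman inequality `carleman_smooth` holds with constants independent of `lam`. -/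
structure IsCarlemanWeight (φ q : ℝ → ℝ) (lam K : ℝ) : Prop where
  contDiff : ContDiff ℝ ∞ φ
  contDiff_slope : ContDiff ℝ ∞ q
  deriv_eq : ∀ r, deriv φ r = lam * q r
  one_le : ∀ r, 1 ≤ q r
  deriv_nonneg : ∀ r, 0 ≤ deriv q r
  deriv_le_one : ∀ r, deriv q r ≤ 1
  abs_deriv_le : ∀ r, |deriv (deriv (deriv q)) r| ≤ K * deriv q r
  nonneg : 0 ≤ K
  le_lam : 1 + 2 * K ≤ lam

section CarlemanWeight

variable {φ q : ℝ → ℝ} {lam K : ℝ}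

theorem IsCarlemanWeight.one_le_lam (hw : IsCarlemanWeight φ q lam K) : 1 ≤ lam := by
  linarith [hw.le_lam, hw.nonneg]

theorem IsCarlemanWeight.zerothOrder_le (hw : IsCarlemanWeight φ q lam K) (r : ℝ) :
    lam ^ 3 * q r ^ 2 * deriv q r ≤ 2 * (lam * q r) ^ 2 * (lam * deriv q r) -
      2 * (lam * deriv (deriv (deriv q)) r) - (lam * deriv q r) ^ 2 := by
  have hlam := hw.one_le_lam
  have hq' := hw.deriv_nonneg r
  have hq'' : deriv q r ^ 2 ≤ deriv q r := pow_le_of_le_one hq' (hw.deriv_le_one r) two_ne_zero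
  have hq''' : deriv (deriv (deriv q)) r ≤ K * deriv q r :=
    (le_abs_self _).trans (hw.abs_deriv_le r)
  have hcubic : 2 * lam * K + lam ^ 2 ≤ lam ^ 3 * q r ^ 2 := by
    have hsq : 2 * K + lam ≤ lam ^ 2 := by nlinarith [hw.le_lam]
    calc 2 * lam * K + lam ^ 2 = lam * (2 * K + lam) := by ring
      _ ≤ lam * lam ^ 2 := by gcongr
      _ = lam ^ 3 * 1 ^ 2 := by ring
      _ ≤ lam ^ 3 * q r ^ 2 := by gcongr; exact hw.one_le r
  calc lam ^ 3 * q r ^ 2 * deriv q r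
      ≤ 2 * lam ^ 3 * q r ^ 2 * deriv q r - (2 * lam * K + lam ^ 2) * deriv q r := by
        linarith [mul_le_mul_of_nonneg_right hcubic hq']
    _ = 2 * (lam * q r) ^ 2 * (lam * deriv q r) - 2 * (lam * (K * deriv q r)) -
          lam ^ 2 * deriv q r := by ring
    _ ≤ 2 * (lam * q r) ^ 2 * (lam * deriv q r) - 2 * (lam * deriv (deriv (deriv q)) r) -
          (lam * deriv q r) ^ 2 := by rw [mul_pow lam (deriv q r)]; gcongr

theorem IsCarlemanWeight.pointwise_le (hw : IsCarlemanWeight φ q lam K) (r : ℝ) {s T y : ℝ}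
    (hy : 0 ≤ y) (hT : 0 ≤ T) (hs : s ≤ 2 * T + 2 * (lam * q r) ^ 2 * y) :
    deriv q r * (lam ^ 3 * y + lam * s) ≤ 3 * (2 * (lam * deriv q r * T) +
      (2 * (lam * q r) ^ 2 * (lam * deriv q r) -
        2 * (lam * deriv (deriv (deriv q)) r) - (lam * deriv q r) ^ 2) * y) := by
  have hlam := hw.one_le_lam
  have hq' := hw.deriv_nonneg r
  have hq : 1 ≤ q r ^ 2 := one_le_pow₀ (hw.one_le r)
  calc deriv q r * (lam ^ 3 * y + lam * s)
      ≤ deriv q r * (lam ^ 3 * (q r ^ 2 * y) + lam * (2 * T + 2 * (lam * q r) ^ 2 * y)) := by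
        gcongr
        exact le_mul_of_one_le_left hy hq
    _ = 2 * (lam * deriv q r * T) + 3 * (lam ^ 3 * q r ^ 2 * deriv q r * y) := by ring
    _ ≤ 3 * (2 * (lam * deriv q r * T)) + 3 * (lam ^ 3 * q r ^ 2 * deriv q r * y) := by
        linarith [mul_nonneg (mul_nonneg (zero_le_one.trans hlam) hq') hT]
    _ = 3 * (2 * (lam * deriv q r * T) + lam ^ 3 * q r ^ 2 * deriv q r * y) := by ring
    _ ≤ _ := by gcongr; exact hw.zerothOrder_le r

end CarlemanWeight

section WeightedFunctions

variable {E : Type*} [NormedAddCommGroup E] [NormedSpace ℝ E] {F : Type*} [NormedAddCommGroup F]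
  {ι : Type*} {e : ι → E} {i₀ : ι} {ℓ : E →L[ℝ] ℝ} {w p : ℝ → ℝ} {v : E → F}

theorem dirDeriv_weight_smul [NormedSpace ℝ F] (hw : ContDiff ℝ ∞ w)
    (hwp : ∀ r, deriv w r = p r * w r) (hv : ContDiff ℝ ∞ v) (d : E) :
    dirDeriv d (fun x => w (ℓ x) • v x) =
      fun x => w (ℓ x) • dirDeriv d v x + (ℓ d * p (ℓ x)) • w (ℓ x) • v x := by
  have hwℓ : ContDiff ℝ ∞ fun x => w (ℓ x) := hw.comp ℓ.contDiff
  rw [dirDeriv_smul hwℓ hv, dirDeriv_comp_clm hw]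
  ext x
  simp only [hwp, smul_eq_mul, smul_smul, mul_assoc]

theorem dirDeriv_dirDeriv_weight_smul [NormedSpace ℝ F] (hw : ContDiff ℝ ∞ w)
    (hp : ContDiff ℝ ∞ p) (hwp : ∀ r, deriv w r = p r * w r) (hv : ContDiff ℝ ∞ v) (d : E)
    (x : E) : dirDeriv d (dirDeriv d fun x => w (ℓ x) • v x) x =
      w (ℓ x) • dirDeriv d (dirDeriv d v) x +
        (ℓ d) • (2 * p (ℓ x)) • w (ℓ x) • dirDeriv d v x +
        (ℓ d ^ 2) • (p (ℓ x) ^ 2 + deriv p (ℓ x)) • w (ℓ x) • v x := by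
  have hwv : ContDiff ℝ ∞ fun x => w (ℓ x) • v x := (hw.comp ℓ.contDiff).smul hv
  have hwv' : ContDiff ℝ ∞ fun x => w (ℓ x) • dirDeriv d v x :=
    (hw.comp ℓ.contDiff).smul (contDiff_dirDeriv hv)
  have hc : ContDiff ℝ ∞ fun r => ℓ d * p r := contDiff_const.mul hp
  have hcℓ : ContDiff ℝ ∞ fun x => ℓ d * p (ℓ x) := hc.comp ℓ.contDiff
  have hcwv : ContDiff ℝ ∞ fun x => (ℓ d * p (ℓ x)) • w (ℓ x) • v x := hcℓ.smul hwv
  rw [dirDeriv_weight_smul hw hwp hv, dirDeriv_add hwv' hcwv, dirDeriv_smul hcℓ hwv,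
    dirDeriv_weight_smul hw hwp (contDiff_dirDeriv hv), dirDeriv_weight_smul hw hwp hv,
    dirDeriv_comp_clm hc]
  simp only [deriv_const_mul_field]
  module

variable [Fintype ι]

theorem sq_mul_gradSqAlong_le [NormedSpace ℝ F] {m : E → ℝ} (hm : ContDiff ℝ ∞ m)
    (hv : ContDiff ℝ ∞ v) (x : E) : m x ^ 2 * gradSqAlong e v x ≤
      2 * gradSqAlong e (fun x => m x • v x) x + 2 * (gradSqAlong e m x * ‖v x‖ ^ 2) := by
  have hterm (i : ι) : m x ^ 2 * ‖dirDeriv (e i) v x‖ ^ 2 ≤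
      2 * ‖dirDeriv (e i) (fun x => m x • v x) x‖ ^ 2 +
        2 * (‖dirDeriv (e i) m x‖ ^ 2 * ‖v x‖ ^ 2) := by
    rw [dirDeriv_smul hm hv]
    calc m x ^ 2 * ‖dirDeriv (e i) v x‖ ^ 2
        = ‖m x • dirDeriv (e i) v x + dirDeriv (e i) m x • v x - dirDeriv (e i) m x • v x‖ ^ 2 := by
          rw [add_sub_cancel_right, norm_smul, mul_pow, Real.norm_eq_abs, sq_abs]
      _ ≤ _ := (pow_le_pow_left₀ (norm_nonneg _) (norm_sub_le _ _) 2).trans add_sq_le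
      _ = _ := by rw [norm_smul (dirDeriv ..), mul_pow, mul_add]
  simp only [gradSqAlong, Finset.mul_sum, Finset.sum_mul, ← Finset.sum_add_distrib]
  exact Finset.sum_le_sum fun i _ => hterm i

theorem gradSqAlong_comp_clm (hℓ₀ : ℓ (e i₀) = 1) (hℓ : ∀ i ≠ i₀, ℓ (e i) = 0)
    (hw : ContDiff ℝ ∞ w) (x : E) : gradSqAlong e (fun x => w (ℓ x)) x = deriv w (ℓ x) ^ 2 := by
  simp only [gradSqAlong, dirDeriv_comp_clm hw, norm_smul, mul_pow, Real.norm_eq_abs, sq_abs]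
  rw [Finset.sum_eq_single i₀ (fun i _ hi => by simp [hℓ i hi]) (by simp), hℓ₀, one_pow, one_mul]

theorem conjLaplaceAlong_weight_smul [InnerProductSpace ℝ F] (hℓ₀ : ℓ (e i₀) = 1)
    (hℓ : ∀ i ≠ i₀, ℓ (e i) = 0) (hw : ContDiff ℝ ∞ w) (hp : ContDiff ℝ ∞ p)
    (hwp : ∀ r, deriv w r = p r * w r) (hv : ContDiff ℝ ∞ v) (x : E) :
    conjLaplaceAlong e i₀ (fun x => p (ℓ x)) (fun x => w (ℓ x) • v x) x =
      w (ℓ x) • laplaceAlong e v x := by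
  have hsingle {a : ι → ℝ} {b : ι → F} (ha : ∀ i ≠ i₀, a i = 0) :
      ∑ i, a i • b i = a i₀ • b i₀ :=
    Finset.sum_eq_single i₀ (fun i _ hi => by rw [ha i hi, zero_smul]) (by simp)
  rw [conjLaplaceAlong, laplaceAlong, dirDeriv_weight_smul hw hwp hv, dirDeriv_comp_clm hp]
  simp only [dirDeriv_dirDeriv_weight_smul hw hp hwp hv, Finset.sum_add_distrib,
    ← Finset.smul_sum]
  rw [hsingle hℓ, hsingle (a := fun i => ℓ (e i) ^ 2) fun i hi => by simp [hℓ i hi], hℓ₀,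
    laplaceAlong]
  module

theorem IsCarlemanWeight.weighted_pointwise_le [NormedSpace ℝ F] {φ q : ℝ → ℝ} {lam K : ℝ}
    (hw : IsCarlemanWeight φ q lam K) (hℓ₀ : ℓ (e i₀) = 1) (hℓ : ∀ i ≠ i₀, ℓ (e i) = 0)
    (hv : ContDiff ℝ ∞ v) (x : E) :
    deriv q (ℓ x) * Real.exp (2 * φ (ℓ x)) * (lam ^ 3 * ‖v x‖ ^ 2 + lam * gradSqAlong e v x) ≤
      3 * (2 * (lam * deriv q (ℓ x) * gradSqAlong e (fun y => Real.exp (φ (ℓ y)) • v y) x) +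
        (2 * (lam * q (ℓ x)) ^ 2 * (lam * deriv q (ℓ x)) -
          2 * (lam * deriv (deriv (deriv q)) (ℓ x)) - (lam * deriv q (ℓ x)) ^ 2) *
            ‖Real.exp (φ (ℓ x)) • v x‖ ^ 2) := by
  have hexp : ContDiff ℝ ∞ fun r => Real.exp (φ r) := hw.contDiff.exp
  have hexp_deriv : deriv (fun r => Real.exp (φ r)) (ℓ x) =
      Real.exp (φ (ℓ x)) * (lam * q (ℓ x)) := by
    rw [deriv_exp (hw.contDiff.differentiable (by simp) _), hw.deriv_eq]
  have hexp_sq : Real.exp (2 * φ (ℓ x)) = Real.exp (φ (ℓ x)) ^ 2 := by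
    rw [← Real.exp_nat_mul, Nat.cast_ofNat]
  have hgrad := sq_mul_gradSqAlong_le (e := e) (hexp.comp ℓ.contDiff) hv x
  simp only [Function.comp_def, gradSqAlong_comp_clm hℓ₀ hℓ hexp, hexp_deriv, mul_pow] at hgrad
  calc _ = deriv q (ℓ x) * (lam ^ 3 * (Real.exp (φ (ℓ x)) ^ 2 * ‖v x‖ ^ 2) +
            lam * (Real.exp (φ (ℓ x)) ^ 2 * gradSqAlong e v x)) := by rw [hexp_sq]; ring
    _ ≤ _ := hw.pointwise_le (ℓ x) (by positivity) (gradSqAlong_nonneg ..) (by linarith)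
    _ = _ := by rw [norm_smul, Real.norm_of_nonneg (Real.exp_nonneg _), mul_pow (Real.exp _)]

end WeightedFunctions

section CarlemanSmooth

variable {E : Type*} [NormedAddCommGroup E] [NormedSpace ℝ E] [FiniteDimensional ℝ E]
  [MeasurableSpace E] [BorelSpace E] {μ : Measure E} [μ.IsAddHaarMeasure]
  {F : Type*} [NormedAddCommGroup F] [InnerProductSpace ℝ F] {ι : Type*} [Fintype ι]
  {e : ι → E} {i₀ : ι} {ℓ : E →L[ℝ] ℝ} {φ q : ℝ → ℝ} {lam K : ℝ} {v : E → F}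

theorem carleman_conjugated_comp {p : ℝ → ℝ} {f : E → F} (hℓ₀ : ℓ (e i₀) = 1)
    (hℓ : ∀ i ≠ i₀, ℓ (e i) = 0) (hp : ContDiff ℝ ∞ p) (hp' : ∀ r, 0 ≤ deriv p r)
    (hf : ContDiff ℝ ∞ f) (hc : HasCompactSupport f) :
    ∫ x, (2 * (deriv p (ℓ x) * gradSqAlong e f x) + (2 * p (ℓ x) ^ 2 * deriv p (ℓ x) -
        2 * deriv (deriv (deriv p)) (ℓ x) - deriv p (ℓ x) ^ 2) * ‖f x‖ ^ 2) ∂μ ≤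
      ∫ x, ‖conjLaplaceAlong e i₀ (fun x => p (ℓ x)) f x‖ ^ 2 ∂μ := by
  have hderiv {r : ℝ → ℝ} (hr : ContDiff ℝ ∞ r) :
      dirDeriv (e i₀) (fun x => r (ℓ x)) = fun x => deriv r (ℓ x) := by
    simp only [dirDeriv_comp_clm hr, hℓ₀, one_smul]
  have hp₁ : ContDiff ℝ ∞ (deriv p) := (contDiff_infty_iff_deriv.1 hp).2
  have hp₂ : ContDiff ℝ ∞ (deriv (deriv p)) := (contDiff_infty_iff_deriv.1 hp₁).2
  have hP : ContDiff ℝ ∞ fun x => p (ℓ x) := hp.comp ℓ.contDiff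
  have h := carleman_conjugated (μ := μ) (i₀ := i₀) hP
    (fun i hi => by rw [dirDeriv_comp_clm hp, hℓ i hi]; simp only [zero_smul]; rfl)
    (fun x => by rw [hderiv hp]; exact hp' _) hf hc
  rwa [hderiv hp, hderiv hp₁, hderiv hp₂] at h

theorem carleman_smooth (hℓ₀ : ℓ (e i₀) = 1) (hℓ : ∀ i ≠ i₀, ℓ (e i) = 0)
    (hw : IsCarlemanWeight φ q lam K) (hv : ContDiff ℝ ∞ v) (hc : HasCompactSupport v) :
    ∫ x, deriv q (ℓ x) * Real.exp (2 * φ (ℓ x)) *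
        (lam ^ 3 * ‖v x‖ ^ 2 + lam * gradSqAlong e v x) ∂μ ≤
      3 * ∫ x, Real.exp (2 * φ (ℓ x)) * ‖laplaceAlong e v x‖ ^ 2 ∂μ := by
  have hq := hw.contDiff_slope
  have hq₁ : ContDiff ℝ ∞ (deriv q) := (contDiff_infty_iff_deriv.1 hq).2
  have hq₃ : ContDiff ℝ ∞ (deriv (deriv (deriv q))) :=
    (contDiff_infty_iff_deriv.1 (contDiff_infty_iff_deriv.1 hq₁).2).2
  let w : ℝ → ℝ := fun r => Real.exp (φ r)
  have hwc : ContDiff ℝ ∞ w := hw.contDiff.exp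
  have hw' (r : ℝ) : deriv w r = lam * q r * w r := by
    rw [← hw.deriv_eq, mul_comm, deriv_exp (hw.contDiff.differentiable (by simp) r)]
  have hw_sq (r : ℝ) : Real.exp (2 * φ r) = w r ^ 2 := by
    rw [← Real.exp_nat_mul, Nat.cast_ofNat]
  let f : E → F := fun x => w (ℓ x) • v x
  have hf : ContDiff ℝ ∞ f := (hwc.comp ℓ.contDiff).smul hv
  have hfc : HasCompactSupport f := hc.smul_left
  have hp : ContDiff ℝ ∞ fun r => lam * q r := contDiff_const.mul hq
  have hlam := zero_le_one.trans hw.one_le_lam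
  have hΔ (x : E) : ‖conjLaplaceAlong e i₀ (fun x => lam * q (ℓ x)) f x‖ ^ 2 =
      Real.exp (2 * φ (ℓ x)) * ‖laplaceAlong e v x‖ ^ 2 := by
    rw [conjLaplaceAlong_weight_smul hℓ₀ hℓ hwc hp hw' hv, norm_smul, mul_pow, Real.norm_eq_abs,
      sq_abs, hw_sq]
  have hconj := carleman_conjugated_comp (μ := μ) hℓ₀ hℓ hp
    (fun r => by rw [deriv_const_mul_field]; exact mul_nonneg hlam (hw.deriv_nonneg r)) hf hfc
  simp only [hΔ, deriv_const_mul_field'] at hconj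
  have hℓc := ℓ.continuous
  have hqc := hq.continuous
  have hq₁c := hq₁.continuous
  have hq₃c := hq₃.continuous
  have hφc := hw.contDiff.continuous
  refine le_trans ?_ (mul_le_mul_of_nonneg_left hconj (zero_le_three (α := ℝ)))
  rw [← integral_const_mul]
  refine integral_mono ?_ ?_ fun x => ?_
  · simp only [mul_add, mul_left_comm _ lam, ← mul_assoc]
    exact (integrable_mul_sq_norm (by fun_prop) hv.continuous hc).add
      (integrable_mul_gradSqAlong (by fun_prop) hv hc)
  · simp only [← mul_assoc]
    exact (((integrable_mul_gradSqAlong (by fun_prop) hf hfc).add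
      (integrable_mul_sq_norm (by fun_prop) hf.continuous hfc)).const_mul 3)
  · exact hw.weighted_pointwise_le hℓ₀ hℓ hv x

end CarlemanSmooth

theorem sq_norm_add₃_le {F : Type*} [SeminormedAddCommGroup F] (a b c : F) :
    ‖a + b + c‖ ^ 2 ≤ 3 * (‖a‖ ^ 2 + ‖b‖ ^ 2 + ‖c‖ ^ 2) :=
  calc ‖a + b + c‖ ^ 2 ≤ (‖a‖ + ‖b‖ + ‖c‖) ^ 2 := by gcongr; exact norm_add₃_le
    _ ≤ _ := by linarith [sq_nonneg (‖a‖ - ‖b‖), sq_nonneg (‖b‖ - ‖c‖), sq_nonneg (‖a‖ - ‖c‖)]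

theorem sq_norm_sum_smul_le {F ι : Type*} [SeminormedAddCommGroup F] [NormedSpace ℝ F] [Fintype ι]
    (a : ι → ℝ) (b : ι → F) :
    ‖∑ i, a i • b i‖ ^ 2 ≤ (∑ i, ‖a i‖ ^ 2) * ∑ i, ‖b i‖ ^ 2 :=
  calc ‖∑ i, a i • b i‖ ^ 2 ≤ (∑ i, ‖a i‖ * ‖b i‖) ^ 2 := by
        gcongr
        exact (norm_sum_le _ _).trans_eq (by simp only [norm_smul])
    _ ≤ _ := Finset.sum_mul_sq_le_sq_mul_sq _ _ _

section Cutoff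

variable {E : Type*} [NormedAddCommGroup E] [NormedSpace ℝ E] {F : Type*} [NormedAddCommGroup F]
  [NormedSpace ℝ F] {ι : Type*} [Fintype ι] {e : ι → E} {m : E → ℝ} {v : E → F}

theorem laplaceAlong_smul (hm : ContDiff ℝ ∞ m) (hv : ContDiff ℝ ∞ v) (x : E) :
    laplaceAlong e (fun x => m x • v x) x = m x • laplaceAlong e v x +
      (2 : ℝ) • ∑ i, dirDeriv (e i) m x • dirDeriv (e i) v x + laplaceAlong e m x • v x := by
  have hterm (i : ι) : dirDeriv (e i) (dirDeriv (e i) fun x => m x • v x) x =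
      m x • dirDeriv (e i) (dirDeriv (e i) v) x +
        (2 : ℝ) • dirDeriv (e i) m x • dirDeriv (e i) v x +
        dirDeriv (e i) (dirDeriv (e i) m) x • v x := by
    have hm' := contDiff_dirDeriv (v := e i) hm
    have hv' := contDiff_dirDeriv (v := e i) hv
    have hmv' : ContDiff ℝ ∞ fun x => m x • dirDeriv (e i) v x := hm.smul hv'
    have hm'v : ContDiff ℝ ∞ fun x => dirDeriv (e i) m x • v x := hm'.smul hv
    rw [dirDeriv_smul hm hv, dirDeriv_add hmv' hm'v, dirDeriv_smul hm hv', dirDeriv_smul hm' hv]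
    module
  simp only [laplaceAlong, hterm, Finset.sum_add_distrib, Finset.smul_sum, Finset.sum_smul]

theorem sq_norm_laplaceAlong_smul_le (hm : ContDiff ℝ ∞ m) (hv : ContDiff ℝ ∞ v) (x : E) :
    ‖laplaceAlong e (fun x => m x • v x) x‖ ^ 2 ≤ 3 * (m x ^ 2 * ‖laplaceAlong e v x‖ ^ 2 +
      4 * (gradSqAlong e m x * gradSqAlong e v x) + laplaceAlong e m x ^ 2 * ‖v x‖ ^ 2) := by
  have hcross := sq_norm_sum_smul_le (fun i => dirDeriv (e i) m x) fun i => dirDeriv (e i) v x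
  rw [laplaceAlong_smul hm hv]
  calc _ ≤ 3 * (‖m x • laplaceAlong e v x‖ ^ 2 +
        ‖(2 : ℝ) • ∑ i, dirDeriv (e i) m x • dirDeriv (e i) v x‖ ^ 2 +
        ‖laplaceAlong e m x • v x‖ ^ 2) := sq_norm_add₃_le ..
    _ = 3 * (m x ^ 2 * ‖laplaceAlong e v x‖ ^ 2 +
        4 * ‖∑ i, dirDeriv (e i) m x • dirDeriv (e i) v x‖ ^ 2 +
        laplaceAlong e m x ^ 2 * ‖v x‖ ^ 2) := by
      simp only [norm_smul, mul_pow, Real.norm_eq_abs, sq_abs]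
      norm_num
    _ ≤ _ := by gcongr; exact hcross

theorem gradSqAlong_smul_le (hm : ContDiff ℝ ∞ m) (hv : ContDiff ℝ ∞ v) (x : E) :
    gradSqAlong e (fun x => m x • v x) x ≤
      2 * (m x ^ 2 * gradSqAlong e v x) + 2 * (gradSqAlong e m x * ‖v x‖ ^ 2) := by
  simp only [gradSqAlong, Finset.mul_sum, Finset.sum_mul, ← Finset.sum_add_distrib]
  refine Finset.sum_le_sum fun i _ => ?_
  rw [dirDeriv_smul hm hv]
  calc _ ≤ (‖m x • dirDeriv (e i) v x‖ + ‖dirDeriv (e i) m x • v x‖) ^ 2 := by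
        gcongr; exact norm_add_le _ _
    _ ≤ _ := add_sq_le
    _ = _ := by
      rw [norm_smul, norm_smul, mul_pow, mul_pow, Real.norm_eq_abs (m x), sq_abs, mul_add]

end Cutoff

section CutoffEstimates

theorem integrable_mul_mul_of_hasCompactSupport {E : Type*} [TopologicalSpace E] [MeasurableSpace E]
    [OpensMeasurableSpace E] {μ : Measure E} [IsFiniteMeasureOnCompacts μ] {m w g : E → ℝ}
    (hm : Continuous m) (hc : HasCompactSupport m) (hw : Continuous w) (hg : Continuous g) :
    Integrable (fun x => m x * w x * g x) μ :=
  ((hm.mul hw).mul hg).integrable_of_hasCompactSupport hc.mul_right.mul_right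

theorem integrable_sq_mul_of_hasCompactSupport {E : Type*} [TopologicalSpace E] [MeasurableSpace E]
    [OpensMeasurableSpace E] {μ : Measure E} [IsFiniteMeasureOnCompacts μ] {m g : E → ℝ}
    (hm : Continuous m) (hc : HasCompactSupport m) (hg : Continuous g) :
    Integrable (fun x => m x ^ 2 * g x) μ := by
  simpa only [sq] using integrable_mul_mul_of_hasCompactSupport hm hc hm hg

variable {E : Type*} [NormedAddCommGroup E] [NormedSpace ℝ E] {F : Type*} [NormedAddCommGroup F]
  {ι : Type*} [Fintype ι] {e : ι → E} {i₀ : ι} {ℓ : E →L[ℝ] ℝ} {φ q : ℝ → ℝ} {lam K : ℝ}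
  {χ κ : E → ℝ} {v : E → F}

theorem continuous_gradSqAlong [NormedSpace ℝ F] (hv : ContDiff ℝ ∞ v) :
    Continuous (gradSqAlong e v) :=
  continuous_finsetSum _ fun _ _ => (contDiff_dirDeriv hv).continuous.norm.pow 2

variable [MeasurableSpace E] [BorelSpace E] {μ : Measure E} [InnerProductSpace ℝ F]

theorem integral_mul_sq_norm_laplaceAlong_smul_le [IsFiniteMeasureOnCompacts μ]
    {w : E → ℝ} {δ : ℝ} (hw : Continuous w) (hw₀ : ∀ x, 0 ≤ w x) (hχ : ContDiff ℝ ∞ χ)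
    (hχc : HasCompactSupport χ) (hκ : Continuous κ) (hκc : HasCompactSupport κ)
    (hgrad : ∀ x, gradSqAlong e χ x ≤ δ * κ x) (hΔ : ∀ x, laplaceAlong e χ x ^ 2 ≤ δ * κ x)
    (hv : ContDiff ℝ ∞ v) :
    ∫ x, w x * ‖laplaceAlong e (fun x => χ x • v x) x‖ ^ 2 ∂μ ≤
      3 * (∫ x, χ x ^ 2 * w x * ‖laplaceAlong e v x‖ ^ 2 ∂μ) +
      δ * (12 * (∫ x, κ x * w x * gradSqAlong e v x ∂μ) +
        3 * ∫ x, κ x * w x * ‖v x‖ ^ 2 ∂μ) := by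
  have hχ2c : HasCompactSupport fun x => χ x ^ 2 := hχc.comp_left (g := (· ^ 2)) (by simp)
  have hΔint := (integrable_mul_mul_of_hasCompactSupport (μ := μ) (hχ.continuous.fun_pow 2) hχ2c hw
    ((contDiff_laplaceAlong (e := e) hv).continuous.norm.fun_pow 2)).const_mul 3
  have hgradint := (integrable_mul_mul_of_hasCompactSupport (μ := μ) hκ hκc hw
    (continuous_gradSqAlong (e := e) hv)).const_mul 12
  have hvint := (integrable_mul_mul_of_hasCompactSupport (μ := μ) hκ hκc hw
    (hv.continuous.norm.fun_pow 2)).const_mul 3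
  have hκint := (hgradint.fun_add hvint).const_mul δ
  simp only [← integral_const_mul]
  rw [← integral_add hgradint hvint, ← integral_const_mul, ← integral_add hΔint hκint]
  refine integral_mono (integrable_mul_sq_norm hw (contDiff_laplaceAlong (hχ.smul hv)).continuous
    (hasCompactSupport_laplaceAlong hχc.smul_right)) (hΔint.fun_add hκint) fun x => ?_
  calc w x * ‖laplaceAlong e (fun x => χ x • v x) x‖ ^ 2
      ≤ w x * (3 * (χ x ^ 2 * ‖laplaceAlong e v x‖ ^ 2 +
          4 * (gradSqAlong e χ x * gradSqAlong e v x) + laplaceAlong e χ x ^ 2 * ‖v x‖ ^ 2)) :=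
        mul_le_mul_of_nonneg_left (sq_norm_laplaceAlong_smul_le hχ hv x) (hw₀ x)
    _ ≤ w x * (3 * (χ x ^ 2 * ‖laplaceAlong e v x‖ ^ 2 +
          4 * (δ * κ x * gradSqAlong e v x) + δ * κ x * ‖v x‖ ^ 2)) := by
        have := gradSqAlong_nonneg e v x
        gcongr
        exacts [hw₀ x, hgrad x, hΔ x]
    _ = _ := by ring

theorem integral_sq_mul_gradSqAlong_le [IsFiniteMeasureOnCompacts μ]
    {a w : E → ℝ} {δ : ℝ} (ha : Continuous a) (hw : Continuous w) (ha₀ : ∀ x, 0 ≤ a x)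
    (haw : ∀ x, a x ≤ w x) (hχ : ContDiff ℝ ∞ χ) (hχc : HasCompactSupport χ) (hκ : Continuous κ)
    (hκc : HasCompactSupport κ) (hgrad : ∀ x, gradSqAlong e χ x ≤ δ * κ x)
    (hv : ContDiff ℝ ∞ v) :
    ∫ x, χ x ^ 2 * a x * gradSqAlong e v x ∂μ ≤
      2 * (∫ x, a x * gradSqAlong e (fun x => χ x • v x) x ∂μ) +
        2 * δ * ∫ x, κ x * w x * ‖v x‖ ^ 2 ∂μ := by
  have hχ2c : HasCompactSupport fun x => χ x ^ 2 := hχc.comp_left (g := (· ^ 2)) (by simp)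
  have hχv : ContDiff ℝ ∞ fun x => χ x • v x := hχ.smul hv
  have hχvc : HasCompactSupport fun x => χ x • v x := hχc.smul_right
  have hχvint := (integrable_mul_gradSqAlong (μ := μ) (e := e) ha hχv hχvc).const_mul 2
  have hvint := (integrable_mul_mul_of_hasCompactSupport (μ := μ) hκ hκc hw
    (hv.continuous.norm.fun_pow 2)).const_mul (2 * δ)
  simp only [← integral_const_mul]
  rw [← integral_add hχvint hvint]
  refine integral_mono (integrable_mul_mul_of_hasCompactSupport (hχ.continuous.fun_pow 2) hχ2c ha
    (continuous_gradSqAlong hv)) (hχvint.fun_add hvint) fun x => ?_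
  calc χ x ^ 2 * a x * gradSqAlong e v x = a x * (χ x ^ 2 * gradSqAlong e v x) := by ring
    _ ≤ a x * (2 * gradSqAlong e (fun x => χ x • v x) x + 2 * (gradSqAlong e χ x * ‖v x‖ ^ 2)) :=
        mul_le_mul_of_nonneg_left (sq_mul_gradSqAlong_le hχ hv x) (ha₀ x)
    _ ≤ 2 * (a x * gradSqAlong e (fun x => χ x • v x) x) +
          2 * (w x * (δ * κ x) * ‖v x‖ ^ 2) := by
        have : a x * gradSqAlong e χ x ≤ w x * (δ * κ x) :=
          mul_le_mul (haw x) (hgrad x) (gradSqAlong_nonneg ..) ((ha₀ x).trans (haw x))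
        linarith [mul_le_mul_of_nonneg_right this (sq_nonneg ‖v x‖)]
    _ = _ := by ring

variable [FiniteDimensional ℝ E] [μ.IsAddHaarMeasure]

theorem carleman_cutoff_smooth {δ : ℝ} (hℓ₀ : ℓ (e i₀) = 1) (hℓ : ∀ i ≠ i₀, ℓ (e i) = 0)
    (hw : IsCarlemanWeight φ q lam K) (hχ : ContDiff ℝ ∞ χ) (hχc : HasCompactSupport χ)
    (hκ : Continuous κ) (hκc : HasCompactSupport κ) (hgrad : ∀ x, gradSqAlong e χ x ≤ δ * κ x)
    (hΔ : ∀ x, laplaceAlong e χ x ^ 2 ≤ δ * κ x) (hv : ContDiff ℝ ∞ v) :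
    lam ^ 3 * (∫ x, χ x ^ 2 * (deriv q (ℓ x) * Real.exp (2 * φ (ℓ x))) * ‖v x‖ ^ 2 ∂μ) +
        lam / 2 * ∫ x, χ x ^ 2 * (deriv q (ℓ x) * Real.exp (2 * φ (ℓ x))) * gradSqAlong e v x ∂μ ≤
      9 * (∫ x, χ x ^ 2 * Real.exp (2 * φ (ℓ x)) * ‖laplaceAlong e v x‖ ^ 2 ∂μ) +
        δ * ((lam + 9) * (∫ x, κ x * Real.exp (2 * φ (ℓ x)) * ‖v x‖ ^ 2 ∂μ) +
          36 * ∫ x, κ x * Real.exp (2 * φ (ℓ x)) * gradSqAlong e v x ∂μ) := by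
  let w : E → ℝ := fun x => Real.exp (2 * φ (ℓ x))
  let a : E → ℝ := fun x => deriv q (ℓ x) * w x
  have hlam := zero_le_one.trans hw.one_le_lam
  have hwc : Continuous w := by have := hw.contDiff.continuous; fun_prop
  have hac : Continuous a :=
    ((contDiff_infty_iff_deriv.1 hw.contDiff_slope).2.continuous.comp ℓ.continuous).mul hwc
  have ha₀ (x : E) : 0 ≤ a x := mul_nonneg (hw.deriv_nonneg _) (Real.exp_pos _).le
  have haw (x : E) : a x ≤ w x := mul_le_of_le_one_left (Real.exp_pos _).le (hw.deriv_le_one _)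
  have hχv : ContDiff ℝ ∞ fun x => χ x • v x := hχ.smul hv
  have hχvc : HasCompactSupport fun x => χ x • v x := hχc.smul_right
  have hcarleman := carleman_smooth (μ := μ) hℓ₀ hℓ hw hχv hχvc
  have hsplit : ∫ x, a x * (lam ^ 3 * ‖χ x • v x‖ ^ 2 +
        lam * gradSqAlong e (fun x => χ x • v x) x) ∂μ =
      lam ^ 3 * (∫ x, χ x ^ 2 * a x * ‖v x‖ ^ 2 ∂μ) +
        lam * ∫ x, a x * gradSqAlong e (fun x => χ x • v x) x ∂μ := by
    have hχ2 (x : E) : χ x ^ 2 * a x * ‖v x‖ ^ 2 = a x * ‖χ x • v x‖ ^ 2 := by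
      rw [norm_smul, mul_pow, Real.norm_eq_abs, sq_abs]; ring
    simp only [hχ2, ← integral_const_mul, mul_add, mul_left_comm (a _)]
    exact integral_add ((integrable_mul_sq_norm hac hχv.continuous hχvc).const_mul _)
      ((integrable_mul_gradSqAlong hac hχv hχvc).const_mul _)
  have hlower := integral_sq_mul_gradSqAlong_le (μ := μ) hac hwc ha₀ haw hχ hχc hκ hκc hgrad hv
  have hupper := integral_mul_sq_norm_laplaceAlong_smul_le (μ := μ) hwc
    (fun x => (Real.exp_pos _).le) hχ hχc hκ hκc hgrad hΔ hv
  simp only [a, w] at hsplit hlower hupper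
  linarith [mul_le_mul_of_nonneg_left hlower hlam]

theorem integral_sq_mul_inner_dirDeriv_dirDeriv_le {d : E} (hχ : ContDiff ℝ ∞ χ)
    (hχc : HasCompactSupport χ) (hv : ContDiff ℝ ∞ v) :
    2 * ∫ x, χ x ^ 2 * ⟪v x, dirDeriv d (dirDeriv d v) x⟫_ℝ ∂μ ≤
      4 * (∫ x, dirDeriv d χ x ^ 2 * ‖v x‖ ^ 2 ∂μ) - ∫ x, χ x ^ 2 * ‖dirDeriv d v x‖ ^ 2 ∂μ := by
  have hv' := contDiff_dirDeriv (v := d) hv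
  have hχ' := contDiff_dirDeriv (v := d) hχ
  have hχv : ContDiff ℝ ∞ fun x => χ x • v x := hχ.smul hv
  have hχvc : HasCompactSupport fun x => χ x • v x := hχc.smul_right
  have hint₁ := integrable_mul_inner (μ := μ) hχ.continuous
    (contDiff_dirDeriv (v := d) hχv).continuous hv'.continuous (hasCompactSupport_dirDeriv hχvc)
  have hint₂ := integrable_mul_inner (μ := μ) hχ'.continuous hχv.continuous hv'.continuous hχvc
  have hparts : ∫ x, χ x ^ 2 * ⟪v x, dirDeriv d (dirDeriv d v) x⟫_ℝ ∂μ =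
      -∫ x, (χ x * ⟪dirDeriv d (fun x => χ x • v x) x, dirDeriv d v x⟫_ℝ +
        dirDeriv d χ x * ⟪χ x • v x, dirDeriv d v x⟫_ℝ) ∂μ := by
    rw [integral_add hint₁ hint₂, neg_add', ← integral_mul_inner_dirDeriv hχ hχv hv' hχvc]
    simp only [real_inner_smul_left, ← mul_assoc, sq]
  have hvint := integrable_sq_mul_of_hasCompactSupport (μ := μ) hχ'.continuous
    (hasCompactSupport_dirDeriv hχc) (hv.continuous.norm.fun_pow 2)
  have hv'int := integrable_sq_mul_of_hasCompactSupport (μ := μ) hχ.continuous hχc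
    (hv'.continuous.norm.fun_pow 2)
  rw [← integral_const_mul 4, ← integral_sub (hvint.const_mul 4) hv'int, hparts, mul_neg,
    ← integral_const_mul, ← integral_neg]
  refine integral_mono ((hint₁.fun_add hint₂).const_mul 2).neg
    ((hvint.const_mul 4).sub hv'int) fun x => ?_
  have hsq := sq_nonneg ‖χ x • dirDeriv d v x + (2 * dirDeriv d χ x) • v x‖
  rw [norm_add_sq_real] at hsq
  simp only [dirDeriv_smul hχ hv, inner_add_left, real_inner_smul_left, real_inner_smul_right,
    real_inner_self_eq_norm_sq, norm_smul, mul_pow, Real.norm_eq_abs, sq_abs,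
    real_inner_comm (v x)] at hsq ⊢
  linarith

theorem caccioppoli_smooth {s : ℝ} (hs : 0 < s) (hχ : ContDiff ℝ ∞ χ) (hχc : HasCompactSupport χ)
    (hv : ContDiff ℝ ∞ v) :
    ∫ x, χ x ^ 2 * gradSqAlong e v x ∂μ ≤
      4 * (∫ x, gradSqAlong e χ x * ‖v x‖ ^ 2 ∂μ) + s * (∫ x, χ x ^ 2 * ‖v x‖ ^ 2 ∂μ) +
        s⁻¹ * ∫ x, χ x ^ 2 * ‖laplaceAlong e v x‖ ^ 2 ∂μ := by
  have hint {g : E → ℝ} (hg : Continuous g) :=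
    integrable_sq_mul_of_hasCompactSupport (μ := μ) hχ.continuous hχc hg
  have hΔ : Continuous (laplaceAlong e v) := (contDiff_laplaceAlong hv).continuous
  have hv'' (i : ι) := (contDiff_dirDeriv (v := e i) (contDiff_dirDeriv (v := e i) hv)).continuous
  have hv0 := hv.continuous
  have henergy : 2 * ∫ x, χ x ^ 2 * ⟪v x, laplaceAlong e v x⟫_ℝ ∂μ ≤
      4 * (∫ x, gradSqAlong e χ x * ‖v x‖ ^ 2 ∂μ) - ∫ x, χ x ^ 2 * gradSqAlong e v x ∂μ := by
    simp only [gradSqAlong, laplaceAlong, inner_sum, Finset.mul_sum, Finset.sum_mul]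
    rw [integral_finsetSum _ fun i _ => hint (hv0.inner (hv'' i)), integral_finsetSum,
      integral_finsetSum, Finset.mul_sum, Finset.mul_sum, ← Finset.sum_sub_distrib]
    · simp only [Real.norm_eq_abs, sq_abs]
      exact Finset.sum_le_sum fun i _ => integral_sq_mul_inner_dirDeriv_dirDeriv_le hχ hχc hv
    · exact fun i _ => hint ((contDiff_dirDeriv hv).continuous.norm.fun_pow 2)
    · simp only [Real.norm_eq_abs, sq_abs]
      exact fun i _ => integrable_sq_mul_of_hasCompactSupport (contDiff_dirDeriv hχ).continuous
        (hasCompactSupport_dirDeriv hχc) (hv0.norm.fun_pow 2)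
  have hyoung : -(2 * ∫ x, χ x ^ 2 * ⟪v x, laplaceAlong e v x⟫_ℝ ∂μ) ≤
      s * (∫ x, χ x ^ 2 * ‖v x‖ ^ 2 ∂μ) + s⁻¹ * ∫ x, χ x ^ 2 * ‖laplaceAlong e v x‖ ^ 2 ∂μ := by
    have hvint := (hint (hv0.norm.fun_pow 2)).const_mul s
    have hΔint := (hint (hΔ.norm.fun_pow 2)).const_mul s⁻¹
    rw [← integral_const_mul, ← integral_neg, ← integral_const_mul, ← integral_const_mul,
      ← integral_add hvint hΔint]
    refine integral_mono ((hint (hv0.inner hΔ)).const_mul 2).neg (hvint.fun_add hΔint) fun x => ?_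
    calc -(2 * (χ x ^ 2 * ⟪v x, laplaceAlong e v x⟫_ℝ))
        = χ x ^ 2 * (2 * -⟪v x, laplaceAlong e v x⟫_ℝ) := by ring
      _ ≤ χ x ^ 2 * (2 * (‖v x‖ * ‖laplaceAlong e v x‖)) := by
        gcongr; exact neg_le_of_neg_le (neg_le_of_abs_le (abs_real_inner_le_norm _ _))
      _ ≤ χ x ^ 2 * (s * ‖v x‖ ^ 2 + s⁻¹ * ‖laplaceAlong e v x‖ ^ 2) := by
        rw [← mul_assoc 2]; gcongr; exact two_mul_le_add_mul_sq hs
      _ = _ := by ring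
  linarith

theorem caccioppoli_weighted_smooth {δ M s : ℝ} (hs : 0 < s) (hℓ₀ : ℓ (e i₀) = 1)
    (hℓ : ∀ i ≠ i₀, ℓ (e i) = 0) (hφ : ContDiff ℝ ∞ φ) (hφM : ∀ r, |deriv φ r| ≤ M)
    (hχ : ContDiff ℝ ∞ χ) (hχc : HasCompactSupport χ) (hκ : Continuous κ)
    (hκc : HasCompactSupport κ) (hχκ : ∀ x, χ x ^ 2 ≤ κ x)
    (hgrad : ∀ x, gradSqAlong e χ x ≤ δ * κ x) (hv : ContDiff ℝ ∞ v) :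
    ∫ x, χ x ^ 2 * Real.exp (2 * φ (ℓ x)) * gradSqAlong e v x ∂μ ≤
      (8 * δ + 8 * M ^ 2 + s) * (∫ x, κ x * Real.exp (2 * φ (ℓ x)) * ‖v x‖ ^ 2 ∂μ) +
        s⁻¹ * ∫ x, χ x ^ 2 * Real.exp (2 * φ (ℓ x)) * ‖laplaceAlong e v x‖ ^ 2 ∂μ := by
  let w : ℝ → ℝ := fun r => Real.exp (φ r)
  have hw : ContDiff ℝ ∞ w := hφ.exp
  have hwℓ : ContDiff ℝ ∞ fun x => w (ℓ x) := hw.comp ℓ.contDiff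
  have hω : ContDiff ℝ ∞ fun x => w (ℓ x) * χ x := hwℓ.mul hχ
  have hw_sq (r : ℝ) : w r ^ 2 = Real.exp (2 * φ r) := by rw [← Real.exp_nat_mul, Nat.cast_ofNat]
  have hw_deriv (r : ℝ) : deriv w r ^ 2 ≤ M ^ 2 * w r ^ 2 := by
    rw [deriv_exp (hφ.differentiable (by simp) r), mul_pow, mul_comm]
    exact mul_le_mul_of_nonneg_right (sq_le_sq.2 ((hφM r).trans (le_abs_self M))) (sq_nonneg _)
  have hω_grad (x : E) : gradSqAlong e (fun x => w (ℓ x) * χ x) x ≤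
      (2 * δ + 2 * M ^ 2) * (κ x * Real.exp (2 * φ (ℓ x))) := by
    calc gradSqAlong e (fun x => w (ℓ x) * χ x) x
        ≤ 2 * (w (ℓ x) ^ 2 * gradSqAlong e χ x) + 2 * (deriv w (ℓ x) ^ 2 * χ x ^ 2) := by
          have := gradSqAlong_smul_le (e := e) hwℓ hχ x
          rwa [gradSqAlong_comp_clm hℓ₀ hℓ hw, Real.norm_eq_abs, sq_abs] at this
      _ ≤ 2 * (w (ℓ x) ^ 2 * (δ * κ x)) + 2 * (M ^ 2 * w (ℓ x) ^ 2 * κ x) := by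
          gcongr
          exacts [hgrad x, hw_deriv _, hχκ x]
      _ = _ := by rw [hw_sq]; ring
  have hvint := integrable_mul_mul_of_hasCompactSupport (μ := μ) (w := fun x => w (ℓ x) ^ 2)
    hκ hκc (hwℓ.continuous.pow 2) (hv.continuous.norm.fun_pow 2)
  simp only [hw_sq] at hvint
  have henergy := caccioppoli_smooth (μ := μ) (e := e) hs hω hχc.mul_left hv
  simp only [mul_pow, hw_sq, mul_comm (Real.exp _)] at henergy
  have hgrad_le : ∫ x, gradSqAlong e (fun x => w (ℓ x) * χ x) x * ‖v x‖ ^ 2 ∂μ ≤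
      (2 * δ + 2 * M ^ 2) * ∫ x, κ x * Real.exp (2 * φ (ℓ x)) * ‖v x‖ ^ 2 ∂μ := by
    rw [← integral_const_mul]
    refine integral_mono_of_nonneg (Eventually.of_forall fun x => ?_) (hvint.const_mul _)
      (Eventually.of_forall fun x => ?_)
    · exact mul_nonneg (gradSqAlong_nonneg ..) (sq_nonneg _)
    · exact (mul_le_mul_of_nonneg_right (hω_grad x) (sq_nonneg _)).trans_eq (mul_assoc ..)
  have hχ_le : ∫ x, χ x ^ 2 * Real.exp (2 * φ (ℓ x)) * ‖v x‖ ^ 2 ∂μ ≤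
      ∫ x, κ x * Real.exp (2 * φ (ℓ x)) * ‖v x‖ ^ 2 ∂μ :=
    integral_mono_of_nonneg (Eventually.of_forall fun x => by positivity) hvint
      (Eventually.of_forall fun x => by dsimp only; gcongr; exact hχκ x)
  linarith [mul_le_mul_of_nonneg_left hχ_le hs.le]

end CutoffEstimates

theorem tendsto_integral_mul_sq_norm {α : Type*} [MeasurableSpace α] {μ : Measure α} {H : Type*}
    [NormedAddCommGroup H] [InnerProductSpace ℝ H] {m : α → ℝ} {M : ℝ}
    (hm : AEStronglyMeasurable m μ) (hM : ∀ᵐ x ∂μ, ‖m x‖ ≤ M) {s : ℕ → α → H} {f : α → H}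
    (hs : ∀ k, MemLp (s k) 2 μ) (hf : MemLp f 2 μ)
    (h : Tendsto (fun k => eLpNorm (s k - f) 2 μ) atTop (𝓝 0)) :
    Tendsto (fun k => ∫ x, m x * ‖s k x‖ ^ 2 ∂μ) atTop (𝓝 (∫ x, m x * ‖f x‖ ^ 2 ∂μ)) := by
  have : Fact ((1 : ℝ≥0∞) ≤ 2) := ⟨by norm_num⟩
  have hle (g : α → H) : ∀ᵐ x ∂μ, ‖m x • g x‖ ≤ M * ‖g x‖ := by
    filter_upwards [hM] with x hx
    rw [norm_smul]
    gcongr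
  have hmul {g : α → H} (hg : MemLp g 2 μ) : MemLp (fun x => m x • g x) 2 μ :=
    hg.of_le_mul (hm.smul hg.1) (hle g)
  have hinner {g : α → H} (hg : MemLp g 2 μ) :
      ∫ x, m x * ‖g x‖ ^ 2 ∂μ = ⟪hg.toLp g, (hmul hg).toLp _⟫_ℝ := by
    rw [L2.inner_def]
    refine integral_congr_ae ?_
    filter_upwards [hg.coeFn_toLp, (hmul hg).coeFn_toLp] with x hx hmx
    rw [hx, hmx, real_inner_smul_right, real_inner_self_eq_norm_sq]
  have hmlim : Tendsto (fun k => eLpNorm ((fun x => m x • s k x) - fun x => m x • f x) 2 μ) atTop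
      (𝓝 0) := by
    have hM0 := ENNReal.Tendsto.const_mul (a := ENNReal.ofReal M) h (.inr ENNReal.ofReal_ne_top)
    rw [mul_zero] at hM0
    refine tendsto_of_tendsto_of_tendsto_of_le_of_le tendsto_const_nhds hM0 (fun _ => zero_le)
      fun k => eLpNorm_le_mul_eLpNorm_of_ae_le_mul ?_ 2
    simpa only [Pi.sub_apply, ← smul_sub] using hle (s k - f)
  rw [hinner hf]
  simp_rw [fun k => hinner (hs k)]
  exact ((Lp.tendsto_Lp_iff_tendsto_eLpNorm'' _ hs _ hf).2 h).inner
    ((Lp.tendsto_Lp_iff_tendsto_eLpNorm'' _ (fun k => hmul (hs k)) _ (hmul hf)).2 hmlim)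

section L2loc

variable {E : Type*} [NormedAddCommGroup E] [MeasureSpace E]

theorem memL2loc_sum {ι : Type*} [Fintype ι] {f : ι → E → ℂ} (hf : ∀ i, MemL2loc (f i)) :
    MemL2loc fun x => ∑ i, f i x := fun K hK => memLp_finsetSum _ fun i _ => hf i K hK

theorem l2locTendsto_sum {ι : Type*} [Fintype ι] {s : ι → ℕ → E → ℂ} {f : ι → E → ℂ}
    (hs : ∀ i k, MemL2loc (s i k)) (hf : ∀ i, MemL2loc (f i))
    (h : ∀ i, L2locTendsto (s i) (f i)) :
    L2locTendsto (fun k x => ∑ i, s i k x) fun x => ∑ i, f i x := fun K hK => by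
  have hsum := tendsto_finsetSum Finset.univ fun i _ => h i K hK
  rw [Finset.sum_const_zero] at hsum
  refine tendsto_of_tendsto_of_tendsto_of_le_of_le tendsto_const_nhds hsum
    (fun _ => zero_le) fun k => le_trans (le_of_eq ?_) (eLpNorm_sum_le (fun i _ =>
      ((hs i k K hK).sub (hf i K hK)).aestronglyMeasurable) (by norm_num))
  congr 1
  ext x
  simp

variable [OpensMeasurableSpace E]

theorem memL2loc_of_continuous [IsFiniteMeasureOnCompacts (volume : Measure E)] {f : E → ℂ}
    (hf : Continuous f) : MemL2loc f := fun K hK => by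
  have : IsFiniteMeasure ((volume : Measure E).restrict K) := ⟨by simpa using hK.measure_lt_top⟩
  obtain ⟨M, hM⟩ := hK.exists_bound_of_continuousOn hf.continuousOn
  exact MemLp.of_bound (hf.continuousOn.aestronglyMeasurable_of_isCompact hK hK.measurableSet) M
    ((ae_restrict_iff' hK.measurableSet).2 (Eventually.of_forall hM))

theorem MemL2loc.integrable_mul_sq_norm {m : E → ℝ} (hm : Continuous m) (hc : HasCompactSupport m)
    {f : E → ℂ} (hf : MemL2loc f) : Integrable (fun x => m x * ‖f x‖ ^ 2) volume := by
  obtain ⟨M, hM⟩ := hm.bounded_above_of_compact_support hc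
  rw [← integrableOn_iff_integrable_of_support_subset
    (Function.support_mul_subset_left _ _ |>.trans (subset_tsupport m))]
  have hK := hf _ hc
  exact (hK.norm.integrable_sq).bdd_mul hm.aestronglyMeasurable (Eventually.of_forall hM)

theorem MemL2loc.integral_mul_sq_norm_mono {m₁ m₂ : E → ℝ} (hm₁ : Continuous m₁)
    (hc₁ : HasCompactSupport m₁) (hm₂ : Continuous m₂) (hc₂ : HasCompactSupport m₂) (hle : m₁ ≤ m₂)
    {f : E → ℂ} (hf : MemL2loc f) : ∫ x, m₁ x * ‖f x‖ ^ 2 ≤ ∫ x, m₂ x * ‖f x‖ ^ 2 :=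
  integral_mono (hf.integrable_mul_sq_norm hm₁ hc₁) (hf.integrable_mul_sq_norm hm₂ hc₂)
    fun x => mul_le_mul_of_nonneg_right (hle x) (sq_nonneg _)

theorem L2locTendsto.tendsto_integral_mul_sq_norm {m : E → ℝ} (hm : Continuous m)
    (hc : HasCompactSupport m) {s : ℕ → E → ℂ} {f : E → ℂ} (hs : ∀ k, MemL2loc (s k))
    (hf : MemL2loc f) (h : L2locTendsto s f) :
    Tendsto (fun k => ∫ x, m x * ‖s k x‖ ^ 2) atTop (𝓝 (∫ x, m x * ‖f x‖ ^ 2)) := by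
  obtain ⟨M, hM⟩ := hm.bounded_above_of_compact_support hc
  have hsupp (g : E → ℂ) : ∫ x in tsupport m, m x * ‖g x‖ ^ 2 = ∫ x, m x * ‖g x‖ ^ 2 :=
    setIntegral_eq_integral_of_forall_compl_eq_zero fun x hx => by
      rw [image_eq_zero_of_notMem_tsupport hx, zero_mul]
  simp only [← hsupp]
  exact Waveguide.tendsto_integral_mul_sq_norm hm.aestronglyMeasurable (Eventually.of_forall hM)
    (fun k => hs k _ hc) (hf _ hc) (h _ hc)

end L2loc

section Approximation

variable {E : Type*} [NormedAddCommGroup E] [NormedSpace ℝ E] [MeasureSpace E] {ι : Type*}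
  {e : ι → E} {u : E → ℂ} {u₁ u₂ : ι → E → ℂ}

/-- `u` has the weak derivatives `u₁ i` and `u₂ i`, of order one and two, in each of the directions
`e i`, and all these functions are in `L²_loc`. -/
structure HasSecondWeakDerivs (e : ι → E) (u : E → ℂ) (u₁ u₂ : ι → E → ℂ) : Prop where
  memL2loc : MemL2loc u
  memL2loc_deriv : ∀ i, MemL2loc (u₁ i)
  memL2loc_deriv₂ : ∀ i, MemL2loc (u₂ i)
  hasWeakDeriv : ∀ i, HasWeakDeriv (e i) u (u₁ i)
  hasWeakDeriv₂ : ∀ i, HasWeakDeriv (e i) (u₁ i) (u₂ i)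

theorem HasSecondWeakDerivs.integrable_mul_sum_sq_norm [OpensMeasurableSpace E] [Fintype ι]
    (h : HasSecondWeakDerivs e u u₁ u₂) {m : E → ℝ} (hm : Continuous m)
    (hc : HasCompactSupport m) : Integrable (fun x => m x * ∑ i, ‖u₁ i x‖ ^ 2) := by
  simp only [Finset.mul_sum]
  exact integrable_finsetSum _ fun i _ => (h.memL2loc_deriv i).integrable_mul_sq_norm hm hc

variable [FiniteDimensional ℝ E] [BorelSpace E] [(volume : Measure E).IsAddHaarMeasure]

theorem dirDeriv_dirDeriv_mollify (φ : ContDiffBump (0 : E)) {v : E} {f g h : E → ℂ}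
    (hfg : HasWeakDeriv v f g) (hgh : HasWeakDeriv v g h) :
    dirDeriv v (dirDeriv v (mollify φ f)) = mollify φ h := by
  rw [show dirDeriv v (mollify φ f) = mollify φ g from funext (fderiv_mollify φ hfg)]
  exact funext (fderiv_mollify φ hgh)

theorem HasSecondWeakDerivs.exists_smooth_approx [Fintype ι] (h : HasSecondWeakDerivs e u u₁ u₂) :
    ∃ s : ℕ → E → ℂ, (∀ k, ContDiff ℝ ∞ (s k)) ∧ L2locTendsto s u ∧
      (∀ i, L2locTendsto (fun k => dirDeriv (e i) (s k)) (u₁ i)) ∧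
      L2locTendsto (fun k => laplaceAlong e (s k)) fun x => ∑ i, u₂ i x := by
  let φ : ℕ → ContDiffBump (0 : E) := fun k =>
    ⟨1 / (k + 2), 1 / (k + 1), by positivity, by gcongr; norm_num⟩
  have hφ : Tendsto (fun k => (φ k).rOut) atTop (𝓝 0) := tendsto_one_div_add_atTop_nhds_zero_nat
  have hsmooth {f : E → ℂ} (hf : MemL2loc f) (k : ℕ) : ContDiff ℝ ∞ (mollify (φ k) f) :=
    contDiff_mollify (φ k) hf.locallyIntegrable
  have hderiv (i : ι) (k : ℕ) : dirDeriv (e i) (mollify (φ k) u) = mollify (φ k) (u₁ i) :=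
    funext (fderiv_mollify (φ k) (h.hasWeakDeriv i))
  have hlaplace (k : ℕ) : laplaceAlong e (mollify (φ k) u) =
      fun x => ∑ i, mollify (φ k) (u₂ i) x := by
    ext x
    simp only [laplaceAlong,
      dirDeriv_dirDeriv_mollify (φ k) (h.hasWeakDeriv _) (h.hasWeakDeriv₂ _)]
  refine ⟨fun k => mollify (φ k) u, hsmooth h.memL2loc, l2locTendsto_mollify hφ h.memL2loc,
    fun i => ?_, ?_⟩
  · simp only [hderiv]
    exact l2locTendsto_mollify hφ (h.memL2loc_deriv i)
  · simp only [hlaplace]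
    exact l2locTendsto_sum
      (fun i k => memL2loc_of_continuous (hsmooth (h.memL2loc_deriv₂ i) k).continuous)
      h.memL2loc_deriv₂
      fun i => l2locTendsto_mollify hφ (h.memL2loc_deriv₂ i)

theorem HasSecondWeakDerivs.exists_tendsto_integral [Fintype ι]
    (h : HasSecondWeakDerivs e u u₁ u₂) :
    ∃ s : ℕ → E → ℂ, (∀ k, ContDiff ℝ ∞ (s k)) ∧
      ∀ m : E → ℝ, Continuous m → HasCompactSupport m →
        Tendsto (fun k => ∫ x, m x * ‖s k x‖ ^ 2) atTop (𝓝 (∫ x, m x * ‖u x‖ ^ 2)) ∧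
        Tendsto (fun k => ∫ x, m x * gradSqAlong e (s k) x) atTop
          (𝓝 (∫ x, m x * ∑ i, ‖u₁ i x‖ ^ 2)) ∧
        Tendsto (fun k => ∫ x, m x * ‖laplaceAlong e (s k) x‖ ^ 2) atTop
          (𝓝 (∫ x, m x * ‖∑ i, u₂ i x‖ ^ 2)) := by
  obtain ⟨s, hs, hu, hu₁, hu₂⟩ := h.exists_smooth_approx
  have hs' (i : ι) (k : ℕ) : MemL2loc (dirDeriv (e i) (s k)) :=
    memL2loc_of_continuous (contDiff_dirDeriv (hs k)).continuous
  refine ⟨s, hs, fun m hm hc => ⟨?_, ?_, ?_⟩⟩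
  · exact hu.tendsto_integral_mul_sq_norm hm hc (fun k => memL2loc_of_continuous (hs k).continuous)
      h.memL2loc
  · simp only [gradSqAlong, Finset.mul_sum]
    rw [integral_finsetSum _ fun i _ => (h.memL2loc_deriv i).integrable_mul_sq_norm hm hc]
    simp_rw [fun k => integral_finsetSum Finset.univ
      fun i _ => (hs' i k).integrable_mul_sq_norm hm hc]
    exact tendsto_finsetSum _ fun i _ =>
      (hu₁ i).tendsto_integral_mul_sq_norm hm hc (hs' i) (h.memL2loc_deriv i)
  · exact hu₂.tendsto_integral_mul_sq_norm hm hc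
      (fun k => memL2loc_of_continuous (contDiff_laplaceAlong (hs k)).continuous)
      (memL2loc_sum h.memL2loc_deriv₂)

end Approximation

section CutoffFunctions

variable {E : Type*} [NormedAddCommGroup E] [NormedSpace ℝ E]

theorem dirDeriv_comp_smul {f : E → ℝ} (hf : Differentiable ℝ f) (v : E) (c : ℝ) :
    dirDeriv v (fun x => f (c • x)) = fun x => c * dirDeriv v f (c • x) := by
  ext x
  have h := (hf (c • x)).hasFDerivAt.comp x ((hasFDerivAt_id x).const_smul c)
  rw [dirDeriv, show (fun x => f (c • x)) = f ∘ fun x => c • x from rfl]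
  simp [h.fderiv, dirDeriv]

variable {ι : Type*} [Fintype ι]

theorem gradSqAlong_comp_smul {f : E → ℝ} (hf : Differentiable ℝ f) (e : ι → E) (c : ℝ) (x : E) :
    gradSqAlong e (fun x => f (c • x)) x = c ^ 2 * gradSqAlong e f (c • x) := by
  simp only [gradSqAlong, dirDeriv_comp_smul hf, norm_mul, mul_pow, Finset.mul_sum,
    Real.norm_eq_abs, sq_abs]

theorem laplaceAlong_comp_smul {f : E → ℝ} (hf : ContDiff ℝ ∞ f) (e : ι → E) (c : ℝ) (x : E) :
    laplaceAlong e (fun x => f (c • x)) x = c ^ 2 * laplaceAlong e f (c • x) := by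
  have hterm (i : ι) : dirDeriv (e i) (dirDeriv (e i) fun x => f (c • x)) x =
      c ^ 2 * dirDeriv (e i) (dirDeriv (e i) f) (c • x) := by
    have hf' : ContDiff ℝ ∞ fun x => dirDeriv (e i) f (c • x) :=
      (contDiff_dirDeriv hf).comp (contDiff_const_smul c)
    rw [dirDeriv_comp_smul (hf.differentiable (by simp))]
    have h := dirDeriv_smul (v := e i) (contDiff_const (c := c)) hf'
    simp only [smul_eq_mul] at h
    rw [h, dirDeriv_comp_smul ((contDiff_dirDeriv hf).differentiable (by simp))]
    simp [dirDeriv]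
    ring
  simp only [laplaceAlong, hterm, Finset.mul_sum]

variable [FiniteDimensional ℝ E]

/-- A smooth cutoff function at scale `R`: it is `1` on the ball of radius `R`, and supported in the
ball of radius `2 * R`. -/
def cutoff (R : ℝ) (x : E) : ℝ :=
  (⟨1, 2, one_pos, one_lt_two⟩ : ContDiffBump (0 : E)) (R⁻¹ • x)

theorem contDiff_cutoff (R : ℝ) : ContDiff ℝ ∞ (cutoff R : E → ℝ) :=
  (ContDiffBump.contDiff _).comp (contDiff_const_smul _)

theorem cutoff_nonneg (R : ℝ) (x : E) : 0 ≤ cutoff R x := ContDiffBump.nonneg _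

theorem cutoff_le_one (R : ℝ) (x : E) : cutoff R x ≤ 1 := ContDiffBump.le_one _

theorem cutoff_sq_le_one (R : ℝ) (x : E) : cutoff R x ^ 2 ≤ 1 :=
  pow_le_one₀ (cutoff_nonneg R x) (cutoff_le_one R x)

theorem cutoff_eq_comp_smul (R : ℝ) : (cutoff R : E → ℝ) = fun x => cutoff 1 (R⁻¹ • x) := by
  simp [funext_iff, cutoff]

variable {R : ℝ}

theorem cutoff_eq_one (hR : 0 < R) {x : E} (hx : ‖x‖ ≤ R) : cutoff R x = 1 := by
  refine ContDiffBump.one_of_mem_closedBall _ (mem_closedBall_zero_iff.2 ?_)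
  rw [norm_smul, norm_inv, Real.norm_of_nonneg hR.le]
  exact inv_mul_le_one_of_le₀ hx hR.le

theorem cutoff_eq_zero (hR : 0 < R) {x : E} (hx : 2 * R ≤ ‖x‖) : cutoff R x = 0 := by
  refine ContDiffBump.zero_of_le_dist _ ?_
  rwa [dist_zero_right, norm_smul, norm_inv, Real.norm_of_nonneg hR.le, le_inv_mul_iff₀ hR,
    mul_comm]

theorem tsupport_cutoff_subset (hR : 0 < R) :
    tsupport (cutoff R : E → ℝ) ⊆ Metric.closedBall 0 (2 * R) :=
  closure_minimal (fun x hx => by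
    rw [mem_closedBall_zero_iff]
    exact le_of_not_ge fun h => hx (cutoff_eq_zero hR h)) Metric.isClosed_closedBall

theorem hasCompactSupport_cutoff (hR : 0 < R) : HasCompactSupport (cutoff R : E → ℝ) :=
  (isCompact_closedBall 0 (2 * R)).of_isClosed_subset (isClosed_tsupport _)
    (tsupport_cutoff_subset hR)

theorem hasCompactSupport_cutoff_sq (hR : 0 < R) :
    HasCompactSupport fun x : E => cutoff R x ^ 2 :=
  (hasCompactSupport_cutoff hR).comp_left (g := (· ^ 2)) (by simp)

theorem cutoff_sq_le_cutoff_two_mul_sq (hR : 0 < R) (x : E) :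
    cutoff R x ^ 2 ≤ cutoff (2 * R) x ^ 2 := by
  rcases le_total ‖x‖ (2 * R) with hx | hx
  · rw [cutoff_eq_one (R := 2 * R) (by positivity) hx, one_pow]
    exact cutoff_sq_le_one R x
  · rw [cutoff_eq_zero hR hx, zero_pow two_ne_zero]
    positivity

theorem exists_cutoff_one_bound (e : ι → E) :
    ∃ B, 0 ≤ B ∧ ∀ x, gradSqAlong e (cutoff 1) x + laplaceAlong e (cutoff 1) x ^ 2 ≤
      B * cutoff 2 x ^ 2 := by
  set g : E → ℝ := fun x => gradSqAlong e (cutoff 1) x + laplaceAlong e (cutoff 1) x ^ 2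
  have hχ : ContDiff ℝ ∞ (cutoff 1 : E → ℝ) := contDiff_cutoff 1
  have hg : Continuous g :=
    (continuous_gradSqAlong hχ).add ((contDiff_laplaceAlong hχ).continuous.pow 2)
  have hg0 (x : E) (hx : 2 < ‖x‖) : g x = 0 := by
    have hx' : x ∉ tsupport (cutoff 1) := fun h => by
      have := mem_closedBall_zero_iff.1 (tsupport_cutoff_subset one_pos h)
      linarith
    simp [g, gradSqAlong_eq_zero_of_notMem_tsupport hx',
      laplaceAlong_eq_zero_of_notMem_tsupport hx']
  obtain ⟨B, hB⟩ := (isCompact_closedBall (0 : E) 2).exists_bound_of_continuousOn hg.continuousOn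
  have hB0 : 0 ≤ B := (norm_nonneg _).trans (hB 0 (by simp))
  refine ⟨B, hB0, fun x => ?_⟩
  rcases le_or_gt ‖x‖ 2 with hx | hx
  · rw [cutoff_eq_one two_pos hx, one_pow, mul_one]
    exact (Real.le_norm_self _).trans (hB x (mem_closedBall_zero_iff.2 hx))
  · exact (hg0 x hx).trans_le (by positivity)

theorem exists_cutoff_bound (e : ι → E) :
    ∃ B, 0 ≤ B ∧ ∀ R, 1 ≤ R →
      (∀ x, gradSqAlong e (cutoff R) x ≤ B / R ^ 2 * cutoff (2 * R) x ^ 2) ∧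
      ∀ x, laplaceAlong e (cutoff R) x ^ 2 ≤ B / R ^ 2 * cutoff (2 * R) x ^ 2 := by
  obtain ⟨B, hB0, hB⟩ := exists_cutoff_one_bound e
  have hχ : ContDiff ℝ ∞ (cutoff 1 : E → ℝ) := contDiff_cutoff 1
  refine ⟨B, hB0, fun R hR => ?_⟩
  have : 0 < R := by positivity
  have hscale (x : E) : cutoff 2 (R⁻¹ • x) = cutoff (2 * R) x := by
    simp only [cutoff, smul_smul, mul_inv]
  have hBx (x : E) := hscale x ▸ hB (R⁻¹ • x)
  have hinv : (R⁻¹ ^ 2) ^ 2 ≤ R⁻¹ ^ 2 :=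
    pow_le_of_le_one (by positivity) (pow_le_one₀ (by positivity) (inv_le_one_of_one_le₀ hR))
      two_ne_zero
  simp only [cutoff_eq_comp_smul R, gradSqAlong_comp_smul (hχ.differentiable (by simp)),
    laplaceAlong_comp_smul hχ, mul_pow, div_eq_inv_mul, ← inv_pow, mul_assoc]
  refine ⟨fun x => ?_, fun x => ?_⟩
  · gcongr
    exact le_of_add_le_of_nonneg_left (hBx x) (sq_nonneg _)
  · gcongr
    exact le_of_add_le_of_nonneg_right (hBx x) (gradSqAlong_nonneg ..)

end CutoffFunctions

section SolutionEstimates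

variable {E : Type*} [NormedAddCommGroup E] [NormedSpace ℝ E] [MeasureSpace E] [BorelSpace E]
  {ι : Type*} [Fintype ι] {e : ι → E} {i₀ : ι} {u : E → ℂ} {u₁ u₂ : ι → E → ℂ} {ℓ : E →L[ℝ] ℝ}
  {φ q : ℝ → ℝ} {lam K A δ M : ℝ} {χ κ : E → ℝ}

theorem HasSecondWeakDerivs.integral_mul_sq_norm_sum_le
    [IsFiniteMeasureOnCompacts (volume : Measure E)] (h : HasSecondWeakDerivs e u u₁ u₂)
    {m p : E → ℝ} (hm : Continuous m) (hm₀ : ∀ x, 0 ≤ m x) (hmc : HasCompactSupport m)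
    (hp : Continuous p)
    (hle : ∀ᵐ x, ‖∑ i, u₂ i x‖ ^ 2 ≤ A * (p x * (‖u x‖ ^ 2 + ∑ i, ‖u₁ i x‖ ^ 2))) :
    ∫ x, m x * ‖∑ i, u₂ i x‖ ^ 2 ≤
      A * ((∫ x, m x * p x * ‖u x‖ ^ 2) + ∫ x, m x * p x * ∑ i, ‖u₁ i x‖ ^ 2) := by
  have hu := h.memL2loc.integrable_mul_sq_norm (hm.fun_mul hp) hmc.mul_right
  have hu₁ := h.integrable_mul_sum_sq_norm (hm.fun_mul hp) hmc.mul_right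
  rw [← integral_add hu hu₁, ← integral_const_mul]
  refine integral_mono_ae ((memL2loc_sum h.memL2loc_deriv₂).integrable_mul_sq_norm hm hmc)
    ((hu.fun_add hu₁).const_mul A) ?_
  filter_upwards [hle] with x hx
  calc m x * ‖∑ i, u₂ i x‖ ^ 2
      ≤ m x * (A * (p x * (‖u x‖ ^ 2 + ∑ i, ‖u₁ i x‖ ^ 2))) := by gcongr; exact hm₀ x
    _ = _ := by ring

variable [FiniteDimensional ℝ E] [(volume : Measure E).IsAddHaarMeasure]

theorem HasSecondWeakDerivs.carleman_cutoff (h : HasSecondWeakDerivs e u u₁ u₂)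
    (hℓ₀ : ℓ (e i₀) = 1) (hℓ : ∀ i ≠ i₀, ℓ (e i) = 0) (hw : IsCarlemanWeight φ q lam K)
    (hχ : ContDiff ℝ ∞ χ) (hχc : HasCompactSupport χ) (hκ : Continuous κ)
    (hκc : HasCompactSupport κ) (hgrad : ∀ x, gradSqAlong e χ x ≤ δ * κ x)
    (hΔ : ∀ x, laplaceAlong e χ x ^ 2 ≤ δ * κ x) :
    lam ^ 3 * (∫ x, χ x ^ 2 * (deriv q (ℓ x) * Real.exp (2 * φ (ℓ x))) * ‖u x‖ ^ 2) +
      lam / 2 * ∫ x, χ x ^ 2 * (deriv q (ℓ x) * Real.exp (2 * φ (ℓ x))) * ∑ i, ‖u₁ i x‖ ^ 2 ≤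
    9 * (∫ x, χ x ^ 2 * Real.exp (2 * φ (ℓ x)) * ‖∑ i, u₂ i x‖ ^ 2) +
      δ * ((lam + 9) * (∫ x, κ x * Real.exp (2 * φ (ℓ x)) * ‖u x‖ ^ 2) +
        36 * ∫ x, κ x * Real.exp (2 * φ (ℓ x)) * ∑ i, ‖u₁ i x‖ ^ 2) := by
  have hexp : Continuous fun x => Real.exp (2 * φ (ℓ x)) := by
    have := hw.contDiff.continuous
    fun_prop
  have hq' : Continuous fun x => deriv q (ℓ x) :=
    (hw.contDiff_slope.continuous_deriv (by simp)).comp ℓ.continuous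
  have hχ2c : HasCompactSupport fun x => χ x ^ 2 := hχc.comp_left (g := (· ^ 2)) (by simp)
  obtain ⟨s, hs, hlim⟩ := h.exists_tendsto_integral
  have hχq' := hlim _ ((hχ.continuous.fun_pow 2).fun_mul (hq'.fun_mul hexp)) hχ2c.mul_right
  have hχE := hlim _ ((hχ.continuous.fun_pow 2).fun_mul hexp) hχ2c.mul_right
  have hκE := hlim _ (hκ.fun_mul hexp) hκc.mul_right
  refine le_of_tendsto_of_tendsto' ((hχq'.1.const_mul (lam ^ 3)).add (hχq'.2.1.const_mul (lam / 2)))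
    ((hχE.2.2.const_mul 9).add
      (((hκE.1.const_mul (lam + 9)).add (hκE.2.1.const_mul 36)).const_mul δ)) fun k => ?_
  exact carleman_cutoff_smooth hℓ₀ hℓ hw hχ hχc hκ hκc hgrad hΔ (hs k)

theorem HasSecondWeakDerivs.caccioppoli_weighted (h : HasSecondWeakDerivs e u u₁ u₂) {s : ℝ}
    (hs : 0 < s) (hℓ₀ : ℓ (e i₀) = 1) (hℓ : ∀ i ≠ i₀, ℓ (e i) = 0) (hφ : ContDiff ℝ ∞ φ)
    (hφM : ∀ r, |deriv φ r| ≤ M) (hχ : ContDiff ℝ ∞ χ) (hχc : HasCompactSupport χ)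
    (hκ : Continuous κ) (hκc : HasCompactSupport κ) (hχκ : ∀ x, χ x ^ 2 ≤ κ x)
    (hgrad : ∀ x, gradSqAlong e χ x ≤ δ * κ x) :
    ∫ x, χ x ^ 2 * Real.exp (2 * φ (ℓ x)) * ∑ i, ‖u₁ i x‖ ^ 2 ≤
      (8 * δ + 8 * M ^ 2 + s) * (∫ x, κ x * Real.exp (2 * φ (ℓ x)) * ‖u x‖ ^ 2) +
        s⁻¹ * ∫ x, χ x ^ 2 * Real.exp (2 * φ (ℓ x)) * ‖∑ i, u₂ i x‖ ^ 2 := by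
  have hexp : Continuous fun x => Real.exp (2 * φ (ℓ x)) := by
    have := hφ.continuous
    fun_prop
  have hχ2c : HasCompactSupport fun x => χ x ^ 2 := hχc.comp_left (g := (· ^ 2)) (by simp)
  obtain ⟨v, hv, hlim⟩ := h.exists_tendsto_integral
  have hχE := hlim _ ((hχ.continuous.fun_pow 2).fun_mul hexp) hχ2c.mul_right
  have hκE := hlim _ (hκ.fun_mul hexp) hκc.mul_right
  refine le_of_tendsto_of_tendsto' hχE.2.1
    ((hκE.1.const_mul (8 * δ + 8 * M ^ 2 + s)).add (hχE.2.2.const_mul s⁻¹)) fun k => ?_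
  exact caccioppoli_weighted_smooth hs hℓ₀ hℓ hφ hφM hχ hχc hκ hκc hχκ hgrad (hv k)

theorem HasSecondWeakDerivs.carleman_absorbed (h : HasSecondWeakDerivs e u u₁ u₂)
    (hℓ₀ : ℓ (e i₀) = 1) (hℓ : ∀ i ≠ i₀, ℓ (e i) = 0) (hw : IsCarlemanWeight φ q lam K)
    (hχ : ContDiff ℝ ∞ χ) (hχc : HasCompactSupport χ) (hκ : Continuous κ)
    (hκc : HasCompactSupport κ) (hgrad : ∀ x, gradSqAlong e χ x ≤ δ * κ x)
    (hΔ : ∀ x, laplaceAlong e χ x ^ 2 ≤ δ * κ x) (hA : 0 ≤ A) (hlam : 18 * A + 1 ≤ lam)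
    (hle : ∀ᵐ x, ‖∑ i, u₂ i x‖ ^ 2 ≤
      A * (deriv q (ℓ x) * (‖u x‖ ^ 2 + ∑ i, ‖u₁ i x‖ ^ 2))) :
    ∫ x, χ x ^ 2 * (deriv q (ℓ x) * Real.exp (2 * φ (ℓ x))) * ‖u x‖ ^ 2 ≤
      δ * ((lam + 9) * (∫ x, κ x * Real.exp (2 * φ (ℓ x)) * ‖u x‖ ^ 2) +
        36 * ∫ x, κ x * Real.exp (2 * φ (ℓ x)) * ∑ i, ‖u₁ i x‖ ^ 2) := by
  have hq' : Continuous fun x => deriv q (ℓ x) :=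
    (hw.contDiff_slope.continuous_deriv (by simp)).comp ℓ.continuous
  have hexp : Continuous fun x => Real.exp (2 * φ (ℓ x)) := by
    have := hw.contDiff.continuous
    fun_prop
  have hχ2c : HasCompactSupport fun x => χ x ^ 2 := hχc.comp_left (g := (· ^ 2)) (by simp)
  have hcarleman := h.carleman_cutoff hℓ₀ hℓ hw hχ hχc hκ hκc hgrad hΔ
  have hsource := h.integral_mul_sq_norm_sum_le ((hχ.continuous.fun_pow 2).fun_mul hexp)
    (fun x => by positivity) hχ2c.mul_right hq' hle
  have hcomm (x : E) : χ x ^ 2 * Real.exp (2 * φ (ℓ x)) * deriv q (ℓ x) =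
      χ x ^ 2 * (deriv q (ℓ x) * Real.exp (2 * φ (ℓ x))) := by ring
  simp only [hcomm] at hsource
  have hm₀ (x : E) : 0 ≤ χ x ^ 2 * (deriv q (ℓ x) * Real.exp (2 * φ (ℓ x))) := by
    have := hw.deriv_nonneg (ℓ x)
    positivity
  have hI : 0 ≤ ∫ x, χ x ^ 2 * (deriv q (ℓ x) * Real.exp (2 * φ (ℓ x))) * ‖u x‖ ^ 2 :=
    integral_nonneg fun x => mul_nonneg (hm₀ x) (sq_nonneg _)
  have hJ : 0 ≤ ∫ x, χ x ^ 2 * (deriv q (ℓ x) * Real.exp (2 * φ (ℓ x))) * ∑ i, ‖u₁ i x‖ ^ 2 :=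
    integral_nonneg fun x => mul_nonneg (hm₀ x) (by positivity)
  have hlam_cube : 9 * A + 1 ≤ lam ^ 3 := by
    have : lam ≤ lam ^ 3 := le_self_pow₀ (by linarith) three_ne_zero
    linarith
  have hlam_half : 9 * A ≤ lam / 2 := by linarith
  linarith [mul_le_mul_of_nonneg_right hlam_cube hI, mul_le_mul_of_nonneg_right hlam_half hJ]

theorem HasSecondWeakDerivs.caccioppoli_absorbed (h : HasSecondWeakDerivs e u u₁ u₂) (hA : 0 < A)
    (hℓ₀ : ℓ (e i₀) = 1) (hℓ : ∀ i ≠ i₀, ℓ (e i) = 0) (hφ : ContDiff ℝ ∞ φ)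
    (hφM : ∀ r, |deriv φ r| ≤ M) (hχ : ContDiff ℝ ∞ χ) (hχc : HasCompactSupport χ)
    (hκ : Continuous κ) (hκc : HasCompactSupport κ) (hχκ : ∀ x, χ x ^ 2 ≤ κ x)
    (hgrad : ∀ x, gradSqAlong e χ x ≤ δ * κ x)
    (hle : ∀ᵐ x, ‖∑ i, u₂ i x‖ ^ 2 ≤ A * (‖u x‖ ^ 2 + ∑ i, ‖u₁ i x‖ ^ 2)) :
    ∫ x, χ x ^ 2 * Real.exp (2 * φ (ℓ x)) * ∑ i, ‖u₁ i x‖ ^ 2 ≤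
      (16 * δ + 16 * M ^ 2 + 4 * A + 1) *
        ∫ x, κ x * Real.exp (2 * φ (ℓ x)) * ‖u x‖ ^ 2 := by
  have hexp : Continuous fun x => Real.exp (2 * φ (ℓ x)) := by
    have := hφ.continuous
    fun_prop
  have hm : Continuous fun x => χ x ^ 2 * Real.exp (2 * φ (ℓ x)) :=
    (hχ.continuous.fun_pow 2).fun_mul hexp
  have hmc : HasCompactSupport fun x => χ x ^ 2 * Real.exp (2 * φ (ℓ x)) :=
    (hχc.comp_left (g := (· ^ 2)) (by simp)).mul_right
  have hcaccioppoli := h.caccioppoli_weighted (s := 2 * A) (by positivity) hℓ₀ hℓ hφ hφM hχ hχc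
    hκ hκc hχκ hgrad
  have hsource := h.integral_mul_sq_norm_sum_le (A := A) hm (fun x => by positivity) hmc
    (p := fun _ => 1) continuous_const (by simpa only [one_mul] using hle)
  simp only [mul_one] at hsource
  have hmono : ∫ x, χ x ^ 2 * Real.exp (2 * φ (ℓ x)) * ‖u x‖ ^ 2 ≤
      ∫ x, κ x * Real.exp (2 * φ (ℓ x)) * ‖u x‖ ^ 2 :=
    h.memL2loc.integral_mul_sq_norm_mono hm hmc (hκ.fun_mul hexp) hκc.mul_right
      fun x => mul_le_mul_of_nonneg_right (hχκ x) (Real.exp_nonneg _)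
  have hhalf := mul_le_mul_of_nonneg_left hsource (a := (2 * A)⁻¹) (by positivity)
  rw [← mul_assoc, show (2 * A)⁻¹ * A = 1 / 2 by field_simp] at hhalf
  linarith

end SolutionEstimates

section Vanishing

variable {E : Type*} [NormedAddCommGroup E] [MeasureSpace E] [BorelSpace E] {u : E → ℂ}
  {w : E → ℝ}

theorem MemL2loc.integrableOn_mul_sq_norm (hu : MemL2loc u) (hw : Continuous w) {K : Set E}
    (hK : IsCompact K) : IntegrableOn (fun x => w x * ‖u x‖ ^ 2) K :=
  IntegrableOn.continuousOn_mul hw.continuousOn (hu K hK).norm.integrable_sq hK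

variable [NormedSpace ℝ E] [FiniteDimensional ℝ E]

theorem integral_cutoff_le_setIntegral {R : ℝ} (hR : 0 < R) (hu : MemL2loc u) (hw : Continuous w)
    (hw₀ : ∀ x, 0 ≤ w x) :
    ∫ x, cutoff R x ^ 2 * w x * ‖u x‖ ^ 2 ≤
      ∫ x in Metric.closedBall 0 (2 * R), w x * ‖u x‖ ^ 2 := by
  have hball : IsCompact (Metric.closedBall (0 : E) (2 * R)) := isCompact_closedBall 0 _
  rw [← setIntegral_eq_integral_of_forall_compl_eq_zero (s := Metric.closedBall 0 (2 * R))
    fun x hx => by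
      rw [cutoff_eq_zero hR (not_le.1 (mt mem_closedBall_zero_iff.2 hx)).le]
      simp]
  refine setIntegral_mono (hu.integrableOn_mul_sq_norm
    (((contDiff_cutoff R).continuous.fun_pow 2).fun_mul hw) hball)
    (hu.integrableOn_mul_sq_norm hw hball) fun x => ?_
  exact mul_le_mul_of_nonneg_right (mul_le_of_le_one_left (hw₀ x) (cutoff_sq_le_one R x))
    (sq_nonneg _)

theorem setIntegral_le_integral_cutoff {r R : ℝ} (hR : 0 < R) (hrR : r ≤ R) (hu : MemL2loc u)
    (hw : Continuous w) (hw₀ : ∀ x, 0 ≤ w x) :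
    ∫ x in Metric.closedBall 0 r, w x * ‖u x‖ ^ 2 ≤ ∫ x, cutoff R x ^ 2 * w x * ‖u x‖ ^ 2 := by
  have hint : Integrable fun x => cutoff R x ^ 2 * w x * ‖u x‖ ^ 2 :=
    hu.integrable_mul_sq_norm (((contDiff_cutoff R).continuous.fun_pow 2).fun_mul hw)
      (hasCompactSupport_cutoff_sq hR).mul_right
  refine le_trans (le_of_eq ?_) (setIntegral_le_integral (s := Metric.closedBall 0 r) hint
    (Eventually.of_forall fun x => mul_nonneg (mul_nonneg (sq_nonneg _) (hw₀ x)) (sq_nonneg _)))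
  refine setIntegral_congr_fun Metric.isClosed_closedBall.measurableSet fun x hx => ?_
  rw [cutoff_eq_one hR ((mem_closedBall_zero_iff.1 hx).trans hrR), one_pow, one_mul]

theorem ae_eq_zero_of_tendsto_integral_cutoff (hu : MemL2loc u) (hw : Continuous w)
    (hw₀ : ∀ x, 0 < w x)
    (hlim : Tendsto (fun R => ∫ x, cutoff R x ^ 2 * w x * ‖u x‖ ^ 2) atTop (𝓝 0)) :
    u =ᵐ[volume] 0 := by
  have hnonneg (x : E) : 0 ≤ w x * ‖u x‖ ^ 2 := mul_nonneg (hw₀ x).le (sq_nonneg _)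
  have hball (k : ℕ) : ∀ᵐ x, x ∈ Metric.closedBall (0 : E) k → u x = 0 := by
    have hle : ∫ x in Metric.closedBall (0 : E) k, w x * ‖u x‖ ^ 2 ≤ 0 := by
      refine ge_of_tendsto hlim ?_
      filter_upwards [eventually_ge_atTop (max 1 (k : ℝ))] with R hR
      exact setIntegral_le_integral_cutoff (one_pos.trans_le ((le_max_left _ _).trans hR))
        ((le_max_right _ _).trans hR) hu hw fun x => (hw₀ x).le
    have hzero := le_antisymm hle (integral_nonneg hnonneg)
    rw [setIntegral_eq_zero_iff_of_nonneg_ae (Eventually.of_forall hnonneg)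
      (hu.integrableOn_mul_sq_norm hw (isCompact_closedBall 0 _)), EventuallyEq,
      ae_restrict_iff' Metric.isClosed_closedBall.measurableSet] at hzero
    filter_upwards [hzero] with x hx hxk
    simpa [(hw₀ x).ne'] using hx hxk
  filter_upwards [ae_all_iff.2 hball] with x hx
  obtain ⟨k, hk⟩ := exists_nat_ge ‖x‖
  exact hx k (mem_closedBall_zero_iff.2 hk)

variable [(volume : Measure E).IsAddHaarMeasure] {ι : Type*} [Fintype ι] {e : ι → E} {i₀ : ι}
  {u₁ u₂ : ι → E → ℂ} {ℓ : E →L[ℝ] ℝ} {φ q : ℝ → ℝ} {lam K A : ℝ}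

theorem HasSecondWeakDerivs.exists_integral_cutoff_sum_sq_le (h : HasSecondWeakDerivs e u u₁ u₂)
    (hA : 0 < A) (hℓ₀ : ℓ (e i₀) = 1) (hℓ : ∀ i ≠ i₀, ℓ (e i) = 0) (hφ : ContDiff ℝ ∞ φ) {M : ℝ}
    (hφM : ∀ r, |deriv φ r| ≤ M)
    (hle : ∀ᵐ x, ‖∑ i, u₂ i x‖ ^ 2 ≤ A * (‖u x‖ ^ 2 + ∑ i, ‖u₁ i x‖ ^ 2)) :
    ∃ D, 0 ≤ D ∧ ∀ R, 1 ≤ R →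
      ∫ x, cutoff R x ^ 2 * Real.exp (2 * φ (ℓ x)) * ∑ i, ‖u₁ i x‖ ^ 2 ≤
        D * ∫ x, cutoff (2 * R) x ^ 2 * Real.exp (2 * φ (ℓ x)) * ‖u x‖ ^ 2 := by
  obtain ⟨B, hB, hcut⟩ := exists_cutoff_bound e
  refine ⟨16 * B + 16 * M ^ 2 + 4 * A + 1, by positivity, fun R hR => ?_⟩
  have hR₀ : 0 < R := by linarith
  have hgrad (x : E) : gradSqAlong e (cutoff R) x ≤ B * cutoff (2 * R) x ^ 2 :=
    ((hcut R hR).1 x).trans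
      (mul_le_mul_of_nonneg_right (div_le_self hB (one_le_pow₀ hR)) (sq_nonneg _))
  exact h.caccioppoli_absorbed hA hℓ₀ hℓ hφ hφM (contDiff_cutoff R) (hasCompactSupport_cutoff hR₀)
    ((contDiff_cutoff (2 * R)).continuous.fun_pow 2) (hasCompactSupport_cutoff_sq (by positivity))
    (cutoff_sq_le_cutoff_two_mul_sq hR₀) hgrad hle

theorem HasSecondWeakDerivs.exists_integral_cutoff_le (h : HasSecondWeakDerivs e u u₁ u₂)
    (hℓ₀ : ℓ (e i₀) = 1) (hℓ : ∀ i ≠ i₀, ℓ (e i) = 0) (hw : IsCarlemanWeight φ q lam K) {Q : ℝ}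
    (hQ : ∀ r, q r ≤ Q) (hA : 0 < A) (hlam : 18 * A + 1 ≤ lam)
    (hle : ∀ᵐ x, ‖∑ i, u₂ i x‖ ^ 2 ≤
      A * (deriv q (ℓ x) * (‖u x‖ ^ 2 + ∑ i, ‖u₁ i x‖ ^ 2))) :
    ∃ D, 0 ≤ D ∧ ∀ R, 1 ≤ R →
      ∫ x, cutoff R x ^ 2 * (deriv q (ℓ x) * Real.exp (2 * φ (ℓ x))) * ‖u x‖ ^ 2 ≤
        D / R ^ 2 * ∫ x, cutoff (2 * (2 * R)) x ^ 2 * Real.exp (2 * φ (ℓ x)) * ‖u x‖ ^ 2 := by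
  have hlam₀ : 0 ≤ lam := by linarith
  have hφM (r : ℝ) : |deriv φ r| ≤ lam * Q := by
    rw [hw.deriv_eq, abs_of_nonneg (mul_nonneg hlam₀ (zero_le_one.trans (hw.one_le r)))]
    exact mul_le_mul_of_nonneg_left (hQ r) hlam₀
  have hle' : ∀ᵐ x, ‖∑ i, u₂ i x‖ ^ 2 ≤ A * (‖u x‖ ^ 2 + ∑ i, ‖u₁ i x‖ ^ 2) := by
    filter_upwards [hle] with x hx
    refine hx.trans (mul_le_mul_of_nonneg_left ?_ hA.le)
    exact mul_le_of_le_one_left (by positivity) (hw.deriv_le_one _)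
  have hexp : Continuous fun x => Real.exp (2 * φ (ℓ x)) := by
    have := hw.contDiff.continuous
    fun_prop
  have hcutE (R : ℝ) : Continuous fun x => cutoff R x ^ 2 * Real.exp (2 * φ (ℓ x)) :=
    ((contDiff_cutoff R).continuous.fun_pow 2).fun_mul hexp
  obtain ⟨B, hB, hcut⟩ := exists_cutoff_bound e
  obtain ⟨D, hD, hcaccioppoli⟩ :=
    h.exists_integral_cutoff_sum_sq_le hA hℓ₀ hℓ hw.contDiff hφM hle'
  refine ⟨B * (lam + 9 + 36 * D), by positivity, fun R hR => ?_⟩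
  have hR₀ : 0 < R := by linarith
  have hmono := h.memL2loc.integral_mul_sq_norm_mono (hcutE (2 * R))
    (hasCompactSupport_cutoff_sq (by positivity)).mul_right (hcutE (2 * (2 * R)))
    (hasCompactSupport_cutoff_sq (by positivity)).mul_right fun x => mul_le_mul_of_nonneg_right
      (cutoff_sq_le_cutoff_two_mul_sq (by positivity) x) (Real.exp_nonneg _)
  have hgrad := hcaccioppoli (2 * R) (by linarith)
  refine (h.carleman_absorbed hℓ₀ hℓ hw (contDiff_cutoff R) (hasCompactSupport_cutoff hR₀)
    ((contDiff_cutoff (2 * R)).continuous.fun_pow 2) (hasCompactSupport_cutoff_sq (by positivity))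
    (hcut R hR).1 (hcut R hR).2 hA.le hlam hle).trans ?_
  refine (mul_le_mul_of_nonneg_left (add_le_add
    (mul_le_mul_of_nonneg_left hmono (by positivity : 0 ≤ lam + 9))
    (mul_le_mul_of_nonneg_left hgrad (by norm_num))) (by positivity)).trans_eq ?_
  ring

theorem HasSecondWeakDerivs.ae_eq_zero (h : HasSecondWeakDerivs e u u₁ u₂)
    (hℓ₀ : ℓ (e i₀) = 1) (hℓ : ∀ i ≠ i₀, ℓ (e i) = 0) (hw : IsCarlemanWeight φ q lam K) {Q : ℝ}
    (hQ : ∀ r, q r ≤ Q) (hpos : ∀ r, 0 < deriv q r) (hA : 0 < A) (hlam : 18 * A + 1 ≤ lam)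
    (hle : ∀ᵐ x, ‖∑ i, u₂ i x‖ ^ 2 ≤
      A * (deriv q (ℓ x) * (‖u x‖ ^ 2 + ∑ i, ‖u₁ i x‖ ^ 2))) {c : ℝ}
    (hmass : ∀ R, 1 ≤ R →
      ∫ x in Metric.closedBall 0 R, Real.exp (2 * φ (ℓ x)) * ‖u x‖ ^ 2 ≤ c * R) :
    u =ᵐ[volume] 0 := by
  have hq' : Continuous fun x => deriv q (ℓ x) :=
    (hw.contDiff_slope.continuous_deriv (by simp)).comp ℓ.continuous
  have hexp : Continuous fun x => Real.exp (2 * φ (ℓ x)) := by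
    have := hw.contDiff.continuous
    fun_prop
  obtain ⟨D, hD, hcut⟩ := h.exists_integral_cutoff_le hℓ₀ hℓ hw hQ hA hlam hle
  refine ae_eq_zero_of_tendsto_integral_cutoff h.memL2loc (hq'.fun_mul hexp)
    (fun x => mul_pos (hpos _) (Real.exp_pos _)) ?_
  have hlim : Tendsto (fun R : ℝ => D * (8 * c) / R) atTop (𝓝 0) :=
    tendsto_const_nhds.div_atTop tendsto_id
  refine tendsto_of_tendsto_of_tendsto_of_le_of_le' tendsto_const_nhds hlim
    (Eventually.of_forall fun R => integral_nonneg fun x => ?_) ?_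
  · have := hpos (ℓ x)
    dsimp only [Pi.zero_apply]
    positivity
  · filter_upwards [eventually_ge_atTop 1] with R hR
    have hbound := (integral_cutoff_le_setIntegral (R := 2 * (2 * R)) (by positivity) h.memL2loc
      hexp fun x => Real.exp_nonneg _).trans (hmass _ (by linarith))
    refine (hcut R hR).trans ((mul_le_mul_of_nonneg_left hbound (by positivity)).trans_eq ?_)
    field_simp
    ring

end Vanishing

section Weight

variable {σ : ℝ}

/-- The function `(1 + r²) ^ (-σ)`, the derivative of the slope of the Carleman weight. -/
def bracket (σ r : ℝ) : ℝ := (1 + r ^ 2) ^ (-σ)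

theorem bracket_pos (σ r : ℝ) : 0 < bracket σ r := Real.rpow_pos_of_pos (by positivity) _

theorem div_rpow_sq_eq_mul_bracket (c σ r : ℝ) :
    (c / (1 + r ^ 2) ^ σ) ^ 2 = c ^ 2 * bracket (2 * σ) r := by
  have hr : (0 : ℝ) ≤ 1 + r ^ 2 := by positivity
  rw [bracket, div_pow, ← Real.rpow_mul_natCast hr, Real.rpow_neg hr, div_eq_mul_inv,
    Nat.cast_ofNat, mul_comm σ]

theorem one_add_sq_mul_bracket_add_one (σ r : ℝ) :
    (1 + r ^ 2) * bracket (σ + 1) r = bracket σ r := by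
  have hr : (0 : ℝ) < 1 + r ^ 2 := by positivity
  rw [bracket, bracket, show -σ = -(σ + 1) + 1 by ring, Real.rpow_add_one hr.ne', mul_comm]

theorem bracket_add_one_le (σ r : ℝ) : bracket (σ + 1) r ≤ bracket σ r := by
  rw [← one_add_sq_mul_bracket_add_one σ r]
  exact le_mul_of_one_le_left (bracket_pos _ r).le (by nlinarith [sq_nonneg r])

theorem sq_mul_bracket_add_one_le (σ r : ℝ) : r ^ 2 * bracket (σ + 1) r ≤ bracket σ r := by
  rw [← one_add_sq_mul_bracket_add_one σ r]
  exact mul_le_mul_of_nonneg_right (by linarith) (bracket_pos _ r).le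

theorem contDiff_bracket (σ : ℝ) : ContDiff ℝ ∞ (bracket σ) :=
  ContDiff.rpow_const_of_ne (by fun_prop) fun r => by positivity

theorem hasDerivAt_bracket (σ r : ℝ) :
    HasDerivAt (bracket σ) (-(2 * σ) * (r * bracket (σ + 1) r)) r := by
  have hbase : HasDerivAt (fun r : ℝ => 1 + r ^ 2) (2 * r) r := by
    simpa using (hasDerivAt_pow 2 r).const_add 1
  convert! hbase.rpow_const (p := -σ) (Or.inl (by positivity)) using 1
  rw [bracket, show -σ - 1 = -(σ + 1) by ring]
  ring

theorem deriv_deriv_bracket (σ r : ℝ) :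
    deriv (deriv (bracket σ)) r =
      4 * σ * (σ + 1) * (r ^ 2 * bracket (σ + 2) r) - 2 * σ * bracket (σ + 1) r := by
  rw [show deriv (bracket σ) = fun r => -(2 * σ) * (r * bracket (σ + 1) r) from
    funext fun r => (hasDerivAt_bracket σ r).deriv]
  refine (((hasDerivAt_id' r).mul (hasDerivAt_bracket (σ + 1) r)).const_mul _).deriv.trans ?_
  rw [add_assoc, one_add_one_eq_two]
  ring

theorem bracket_le_one (hσ : 0 ≤ σ) (r : ℝ) : bracket σ r ≤ 1 :=
  Real.rpow_le_one_of_one_le_of_nonpos (by nlinarith [sq_nonneg r]) (by linarith)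

theorem abs_deriv_deriv_bracket_le (hσ : 0 ≤ σ) (r : ℝ) :
    |deriv (deriv (bracket σ)) r| ≤ (2 * σ + 4 * σ * (σ + 1)) * bracket σ r := by
  have hsq_mul : r ^ 2 * bracket (σ + 2) r ≤ bracket σ r := by
    rw [show σ + 2 = σ + 1 + 1 by ring]
    exact (sq_mul_bracket_add_one_le (σ + 1) r).trans (bracket_add_one_le σ r)
  have hpos₁ := bracket_pos (σ + 1) r
  have hpos₂ := bracket_pos (σ + 2) r
  rw [deriv_deriv_bracket, add_comm (2 * σ), add_mul]
  refine (abs_sub _ _).trans (add_le_add ?_ ?_)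
  · rw [abs_of_nonneg (by positivity)]
    gcongr
  · rw [abs_of_nonneg (by positivity)]
    gcongr
    exact bracket_add_one_le σ r

theorem integrable_bracket (hσ : 1 / 2 < σ) : Integrable (bracket σ) := by
  have h := integrable_rpow_neg_one_add_norm_sq (E := ℝ) (μ := volume) (r := 2 * σ)
    (by rw [Module.finrank_self, Nat.cast_one]; linarith)
  simp only [Real.norm_eq_abs, sq_abs, neg_div, mul_div_cancel_left₀ σ two_ne_zero] at h
  exact h

/-- The integral of `bracket σ` over the line. -/
def bracketMass (σ : ℝ) : ℝ := ∫ r, bracket σ r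

theorem bracketMass_nonneg (σ : ℝ) : 0 ≤ bracketMass σ :=
  integral_nonneg fun r => (bracket_pos σ r).le

theorem abs_integral_bracket_le (hσ : 1 / 2 < σ) (r : ℝ) :
    |∫ s in (0 : ℝ)..r, bracket σ s| ≤ bracketMass σ := by
  refine (intervalIntegral.norm_integral_le_integral_norm_uIoc (f := bracket σ)).trans ?_
  simp only [Real.norm_of_nonneg (bracket_pos σ _).le]
  exact setIntegral_le_integral (integrable_bracket hσ)
    (Eventually.of_forall fun s => (bracket_pos σ s).le)

/-- The slope of the Carleman weight: the antiderivative of `bracket σ` normalized so that its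
values lie between `1` and `1 + 2 * bracketMass σ`. -/
def weightSlope (σ r : ℝ) : ℝ := 1 + bracketMass σ + ∫ s in (0 : ℝ)..r, bracket σ s

theorem hasDerivAt_weightSlope (σ r : ℝ) : HasDerivAt (weightSlope σ) (bracket σ r) r :=
  ((contDiff_bracket σ).continuous.integral_hasStrictDerivAt 0 r).hasDerivAt.const_add _

theorem deriv_weightSlope (σ : ℝ) : deriv (weightSlope σ) = bracket σ :=
  funext fun r => (hasDerivAt_weightSlope σ r).deriv

theorem contDiff_weightSlope (σ : ℝ) : ContDiff ℝ ∞ (weightSlope σ) := by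
  rw [contDiff_infty_iff_deriv, deriv_weightSlope]
  exact ⟨fun r => (hasDerivAt_weightSlope σ r).differentiableAt, contDiff_bracket σ⟩

theorem one_le_weightSlope (hσ : 1 / 2 < σ) (r : ℝ) : 1 ≤ weightSlope σ r := by
  rw [weightSlope]
  linarith [(abs_le.1 (abs_integral_bracket_le hσ r)).1]

theorem weightSlope_le (hσ : 1 / 2 < σ) (r : ℝ) : weightSlope σ r ≤ 1 + 2 * bracketMass σ := by
  rw [weightSlope]
  linarith [(abs_le.1 (abs_integral_bracket_le hσ r)).2]

/-- The exponent of the Carleman weight: the antiderivative of `lam * weightSlope σ` vanishing at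
`0`. -/
def weightExponent (σ lam r : ℝ) : ℝ := lam * ∫ s in (0 : ℝ)..r, weightSlope σ s

theorem hasDerivAt_weightExponent (σ lam r : ℝ) :
    HasDerivAt (weightExponent σ lam) (lam * weightSlope σ r) r :=
  ((contDiff_weightSlope σ).continuous.integral_hasStrictDerivAt 0 r).hasDerivAt.const_mul _

theorem weightExponent_le (hσ : 1 / 2 < σ) {lam : ℝ} (hlam : 0 ≤ lam) (r : ℝ) :
    weightExponent σ lam r ≤ lam * ((1 + 2 * bracketMass σ) * |r|) := by
  refine mul_le_mul_of_nonneg_left ((le_abs_self _).trans ?_) hlam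
  have hslope (s : ℝ) : ‖weightSlope σ s‖ ≤ 1 + 2 * bracketMass σ := by
    rw [Real.norm_of_nonneg (zero_le_one.trans (one_le_weightSlope hσ s))]
    exact weightSlope_le hσ s
  simpa only [sub_zero, Real.norm_eq_abs] using
    intervalIntegral.norm_integral_le_of_norm_le_const (a := 0) (b := r) fun s _ => hslope s

theorem isCarlemanWeight_weightExponent (hσ : 1 / 2 < σ) {lam : ℝ}
    (hlam : 1 + 2 * (2 * σ + 4 * σ * (σ + 1)) ≤ lam) :
    IsCarlemanWeight (weightExponent σ lam) (weightSlope σ) lam (2 * σ + 4 * σ * (σ + 1)) where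
  contDiff := by
    rw [contDiff_infty_iff_deriv, show deriv (weightExponent σ lam) = fun r => lam * weightSlope σ r
      from funext fun r => (hasDerivAt_weightExponent σ lam r).deriv]
    exact ⟨fun r => (hasDerivAt_weightExponent σ lam r).differentiableAt,
      contDiff_const.mul (contDiff_weightSlope σ)⟩
  contDiff_slope := contDiff_weightSlope σ
  deriv_eq r := (hasDerivAt_weightExponent σ lam r).deriv
  one_le := one_le_weightSlope hσ
  deriv_nonneg r := by
    rw [deriv_weightSlope]
    exact (bracket_pos σ r).le
  deriv_le_one r := by
    rw [deriv_weightSlope]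
    exact bracket_le_one (by linarith) r
  abs_deriv_le r := by
    rw [deriv_weightSlope]
    exact abs_deriv_deriv_bracket_le (by linarith) r
  nonneg := by positivity
  le_lam := hlam

end Weight

section SecondWeakDerivs

variable {E : Type*} [NormedAddCommGroup E] [MeasureSpace E]

theorem MemL2loc.congr {f g : E → ℂ} (hf : MemL2loc f) (h : f =ᵐ[volume] g) : MemL2loc g :=
  fun K hK => (memLp_congr_ae (ae_restrict_of_ae h)).1 (hf K hK)

variable [NormedSpace ℝ E] {v : E} {f g : E → ℂ}

theorem HasWeakDeriv.hasWeakDeriv_weakDeriv (h : HasWeakDeriv v f g) :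
    HasWeakDeriv v f (weakDeriv v f) := by
  have hex : ∃ g, HasWeakDeriv v f g := ⟨g, h⟩
  rw [weakDeriv, dif_pos hex]
  exact hex.choose_spec

variable [FiniteDimensional ℝ E] [BorelSpace E]

theorem HasWeakDeriv.ae_eq {g' : E → ℂ} (h : HasWeakDeriv v f g) (h' : HasWeakDeriv v f g') :
    g =ᵐ[volume] g' :=
  ae_eq_of_integral_contDiff_smul_eq h.locallyIntegrable_deriv h'.locallyIntegrable_deriv
    fun φ hφ hc => neg_injective <|
      (h.integral_eq φ hφ hc).symm.trans (h'.integral_eq φ hφ hc)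

theorem HasWeakDeriv.ae_eq_weakDeriv (h : HasWeakDeriv v f g) : g =ᵐ[volume] weakDeriv v f :=
  h.ae_eq h.hasWeakDeriv_weakDeriv

theorem MemHloc.hasSecondWeakDerivs {ι : Type*} {u : E → ℂ} (hu : MemHloc 2 u) (e : ι → E) :
    HasSecondWeakDerivs e u (fun i => weakDeriv (e i) u)
      fun i => weakDeriv (e i) (weakDeriv (e i) u) := by
  choose g hg hgL2 hgderiv using hu.2
  choose k hk hkL2 using fun v => hgderiv v v
  have hk' (v : E) : HasWeakDeriv v (weakDeriv v u) (k v) :=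
    (hk v).congr (hg v).ae_eq_weakDeriv.symm .rfl
  exact
    { memL2loc := hu.1
      memL2loc_deriv := fun i => (hgL2 (e i)).congr (hg (e i)).ae_eq_weakDeriv
      memL2loc_deriv₂ := fun i => MemL2loc.congr (hkL2 (e i)) (hk' (e i)).ae_eq_weakDeriv
      hasWeakDeriv := fun i => (hg (e i)).hasWeakDeriv_weakDeriv
      hasWeakDeriv₂ := fun i => (hk' (e i)).hasWeakDeriv_weakDeriv }

end SecondWeakDerivs

theorem setIntegral_closedBall_le_of_lintegral_slice_le {F : Type*} [NormedAddCommGroup F]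
    [MeasureSpace F] [SFinite (volume : Measure F)] {f : ℝ × F → ℝ} (hf : AEStronglyMeasurable f)
    (hf₀ : ∀ z, 0 ≤ f z) {S : ℝ≥0∞} (hS : S ≠ ⊤)
    (hle : ∀ t, ∫⁻ x, ENNReal.ofReal (f (t, x)) ≤ S) {R : ℝ} (hR : 0 ≤ R) :
    ∫ z in Metric.closedBall 0 R, f z ≤ 2 * S.toReal * R := by
  rw [integral_eq_lintegral_of_nonneg_ae (Eventually.of_forall hf₀) hf.restrict]
  refine ENNReal.toReal_le_of_le_ofReal (by positivity) ?_
  have hsub : Metric.closedBall (0 : ℝ × F) R ⊆ Set.Icc (-R) R ×ˢ Set.univ := fun z hz =>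
    ⟨abs_le.1 ((norm_fst_le z).trans (mem_closedBall_zero_iff.1 hz)), Set.mem_univ _⟩
  have hmeas : AEMeasurable (fun z => ENNReal.ofReal (f z))
      (((volume : Measure ℝ).restrict (Set.Icc (-R) R)).prod (volume : Measure F)) :=
    hf.aemeasurable.ennreal_ofReal.mono_ac
      (Measure.restrict_le_self.absolutelyContinuous.prod .rfl)
  calc ∫⁻ z in Metric.closedBall 0 R, ENNReal.ofReal (f z)
      ≤ ∫⁻ z in Set.Icc (-R) R ×ˢ Set.univ, ENNReal.ofReal (f z) := lintegral_mono_set hsub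
    _ = ∫⁻ t in Set.Icc (-R) R, ∫⁻ x, ENNReal.ofReal (f (t, x)) := by
        rw [Measure.volume_eq_prod, ← Measure.prod_restrict, Measure.restrict_univ,
          lintegral_prod _ hmeas]
    _ ≤ ∫⁻ _ in Set.Icc (-R) R, S := lintegral_mono fun t => hle t
    _ = ENNReal.ofReal (2 * S.toReal * R) := by
        rw [setLIntegral_const, Real.volume_Icc, show R - -R = 2 * R by ring,
          show 2 * S.toReal * R = S.toReal * (2 * R) by ring,
          ENNReal.ofReal_mul ENNReal.toReal_nonneg, ENNReal.ofReal_toReal hS]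

section SpaceTime

variable {n : ℕ}

instance : (volume : Measure (SpaceTime n)).IsAddHaarMeasure :=
  inferInstanceAs ((volume : Measure ℝ).prod (volume : Measure (Space n))).IsAddHaarMeasure

/-- The coordinate directions of space-time, indexed so that `∂_t² + Δ` is a sum over a single index
type; `none` is the time direction. -/
def dir : Option (Fin n) → SpaceTime n
  | none => dirT n
  | some j => dirX j

/-- The coordinate `x_j` on space-time, along which the Carleman weight varies. -/
def coordX (j : Fin n) : SpaceTime n →L[ℝ] ℝ :=
  (EuclideanSpace.proj j).comp (ContinuousLinearMap.snd ℝ ℝ (Space n))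

theorem coordX_dir_self (j : Fin n) : coordX j (dir (some j)) = 1 := by
  simp [coordX, dir, dirX]

theorem coordX_dir_of_ne (j : Fin n) {i : Option (Fin n)} (hi : i ≠ some j) :
    coordX j (dir i) = 0 := by
  cases i with
  | none => simp [coordX, dir, dirT]
  | some k =>
    have hk : j ≠ k := fun h => hi (h ▸ rfl)
    simp [coordX, dir, dirX, hk]

theorem laplaceTX_eq_sum (u : SpaceTime n → ℂ) (z : SpaceTime n) :
    laplaceTX u z = ∑ i, weakDeriv (dir i) (weakDeriv (dir i) u) z := by
  rw [Fintype.sum_option]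
  rfl

theorem norm_firstOrder_le (W : SpaceTime n → Covec n) (u : SpaceTime n → ℂ) (z : SpaceTime n) :
    ‖firstOrder W u z‖ ≤ ‖W z‖ * √(∑ i, ‖weakDeriv (dir i) u z‖ ^ 2) := by
  let w : Option (Fin n) → ℂ := fun i => i.elim (W z).fst fun j => (W z).snd j
  have hfirstOrder : firstOrder W u z = ∑ i, w i * weakDeriv (dir i) u z := by
    rw [Fintype.sum_option]
    rfl
  have hnorm : ‖W z‖ = √(∑ i, ‖w i‖ ^ 2) := by
    rw [Fintype.sum_option, WithLp.prod_norm_eq_of_L2, EuclideanSpace.norm_sq_eq]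
    rfl
  rw [hfirstOrder, hnorm]
  refine (norm_sum_le _ _).trans ?_
  simp only [norm_mul]
  exact Real.sum_mul_le_sqrt_mul_sqrt _ _ _

theorem norm_sq_laplaceTX_le {c : ℝ} {v : ℂ} {W : SpaceTime n → Covec n} {u : SpaceTime n → ℂ}
    {z : SpaceTime n} (hv : ‖v‖ ≤ c) (hW : ‖W z‖ ≤ c)
    (h : ‖laplaceTX u z‖ ≤ ‖v * u z‖ + ‖firstOrder W u z‖) :
    ‖laplaceTX u z‖ ^ 2 ≤ 2 * c ^ 2 * (‖u z‖ ^ 2 + ∑ i, ‖weakDeriv (dir i) u z‖ ^ 2) := by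
  set S := ∑ i, ‖weakDeriv (dir i) u z‖ ^ 2
  have hS : 0 ≤ S := Finset.sum_nonneg fun i _ => sq_nonneg _
  have hle : ‖laplaceTX u z‖ ≤ c * (‖u z‖ + √S) := by
    refine h.trans ?_
    rw [norm_mul, mul_add]
    exact add_le_add (by gcongr) ((norm_firstOrder_le W u z).trans (by gcongr))
  calc ‖laplaceTX u z‖ ^ 2 ≤ (c * (‖u z‖ + √S)) ^ 2 := by gcongr
    _ = c ^ 2 * (‖u z‖ + √S) ^ 2 := mul_pow ..
    _ ≤ c ^ 2 * (2 * (‖u z‖ ^ 2 + √S ^ 2)) := by gcongr; exact add_sq_le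
    _ = 2 * c ^ 2 * (‖u z‖ ^ 2 + S) := by rw [Real.sq_sqrt hS]; ring

theorem norm_sq_sum_weakDeriv_le_bracket {c ρ r : ℝ} {v : ℂ} {W : SpaceTime n → Covec n}
    {u : SpaceTime n → ℂ} {z : SpaceTime n} (hv : ‖v‖ ≤ c / (1 + r ^ 2) ^ ρ)
    (hW : ‖W z‖ ≤ c / (1 + r ^ 2) ^ ρ) (h : ‖laplaceTX u z‖ ≤ ‖v * u z‖ + ‖firstOrder W u z‖) :
    ‖∑ i, weakDeriv (dir i) (weakDeriv (dir i) u) z‖ ^ 2 ≤ 2 * c ^ 2 *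
      (bracket (2 * ρ) r * (‖u z‖ ^ 2 + ∑ i, ‖weakDeriv (dir i) u z‖ ^ 2)) := by
  rw [← laplaceTX_eq_sum, ← mul_assoc, mul_assoc 2, ← div_rpow_sq_eq_mul_bracket]
  exact norm_sq_laplaceTX_le hv hW h

theorem setIntegral_closedBall_weight_le {σ μ lam : ℝ} (hσ : 1 / 2 < σ) (hμ : 0 ≤ μ)
    (hμlam : μ * (1 + 2 * bracketMass σ) = 2 * lam) (j : Fin n) {u : SpaceTime n → ℂ}
    (hu : AEStronglyMeasurable u)
    (hfin : (⨆ t : ℝ, ∫⁻ x : Space n,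
      ENNReal.ofReal (Real.exp (4 * lam * |x j|) * ‖u (t, x)‖ ^ 2)) < ⊤) {R : ℝ} (hR : 0 ≤ R) :
    ∫ z in Metric.closedBall 0 R,
        Real.exp (2 * weightExponent σ μ (coordX j z)) * ‖u z‖ ^ 2 ≤
      2 * (⨆ t : ℝ, ∫⁻ x : Space n,
        ENNReal.ofReal (Real.exp (4 * lam * |x j|) * ‖u (t, x)‖ ^ 2)).toReal * R := by
  have hexp : Continuous fun z => Real.exp (2 * weightExponent σ μ (coordX j z)) := by
    have : Continuous (weightExponent σ μ) :=
      continuous_iff_continuousAt.2 fun r => (hasDerivAt_weightExponent σ μ r).continuousAt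
    fun_prop
  refine setIntegral_closedBall_le_of_lintegral_slice_le
    (f := fun z => Real.exp (2 * weightExponent σ μ (coordX j z)) * ‖u z‖ ^ 2)
    (hexp.aestronglyMeasurable.mul (hu.norm.pow 2)) (fun z => by positivity) hfin.ne
    (fun t => ?_) hR
  refine (lintegral_mono fun x => ?_).trans (le_iSup (fun t : ℝ => ∫⁻ x : Space n,
    ENNReal.ofReal (Real.exp (4 * lam * |x j|) * ‖u (t, x)‖ ^ 2)) t)
  have hle : 2 * weightExponent σ μ (x j) ≤ 4 * lam * |x j| := by
    have := weightExponent_le hσ hμ (x j)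
    rw [← mul_assoc, hμlam] at this
    linarith
  exact ENNReal.ofReal_le_ofReal
    (mul_le_mul_of_nonneg_right (Real.exp_le_exp.2 hle) (sq_nonneg _))

theorem IsC1H1.slice_ae_eq_zero {u : SpaceTime n → ℂ} (hu : IsC1H1 u) (h0 : u =ᵐ[volume] 0)
    (t : ℝ) : (fun x => u (t, x)) =ᵐ[volume] 0 := by
  obtain ⟨U, hU, hUu⟩ := hu
  let F : ℝ → L2 n := fun t => (U t).1.fst
  have hF : Continuous F :=
    (WithLp.prod_continuous_ofLp 2 _ _).fst.comp (continuous_subtype_val.comp hU.continuous)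
  have hF_ae : F =ᵐ[volume] fun _ => 0 := by
    rw [Measure.volume_eq_prod] at h0
    filter_upwards [Measure.ae_ae_of_ae_prod h0] with s hs
    exact (Lp.eq_zero_iff_ae_eq_zero).2 ((hUu s).symm.trans hs)
  have hF_eq : F t = 0 := congrFun ((hF.ae_eq_iff_eq volume continuous_const).1 hF_ae) t
  exact (hUu t).trans ((Lp.eq_zero_iff_ae_eq_zero).1 hF_eq)

theorem div_rpow_norm_le_coord {c ρ : ℝ} (hc : 0 ≤ c) (hρ : 0 ≤ ρ) (x : Space n) (j : Fin n) :
    c / (1 + ‖x‖ ^ 2) ^ ρ ≤ c / (1 + x j ^ 2) ^ ρ := by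
  have hcoord : x j ^ 2 ≤ ‖x‖ ^ 2 := sq_le_sq.2 (by simpa using PiLp.norm_apply_le x j)
  gcongr

theorem iSup_lintegral_exp_coord_le {a : ℝ} (ha : 0 ≤ a) (j : Fin n) (u : SpaceTime n → ℂ) :
    (⨆ t : ℝ, ∫⁻ x : Space n, ENNReal.ofReal (Real.exp (a * |x j|) * ‖u (t, x)‖ ^ 2)) ≤
      ⨆ t : ℝ, ∫⁻ x : Space n, ENNReal.ofReal (Real.exp (a * ‖x‖) * ‖u (t, x)‖ ^ 2) := by
  refine iSup_mono fun t => lintegral_mono fun x => ?_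
  have hcoord : |x j| ≤ ‖x‖ := PiLp.norm_apply_le x j
  dsimp only
  gcongr

end SpaceTime

end Waveguide

end

open Waveguide in
theorem theorem1_general {n : ℕ} (j : Fin n) {ρ : ℝ} (hρ : 1 / 4 < ρ) (C : ℝ) :
    ∃ lam₀ : ℝ,
      ∀ (V : SpaceTime n → ℂ) (W : SpaceTime n → Covec n),
        (∀ᵐ z : SpaceTime n, ‖V z‖ ≤ C / (1 + z.2 j ^ 2) ^ ρ) →
        (∀ᵐ z : SpaceTime n, ‖W z‖ ≤ C / (1 + z.2 j ^ 2) ^ ρ) →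
        ∀ u : SpaceTime n → ℂ,
          MemHloc 2 u →
          (∀ᵐ z : SpaceTime n, ‖laplaceTX u z‖ ≤ ‖V z * u z‖ + ‖firstOrder W u z‖) →
          ∀ lam : ℝ, lam₀ < lam →
            (⨆ t : ℝ, ∫⁻ x : Space n,
              ENNReal.ofReal (Real.exp (4 * lam * |x j|) * ‖u (t, x)‖ ^ 2)) < ⊤ →
            u =ᵐ[volume] 0 := by
  have hσ : 1 / 2 < 2 * ρ := by linarith
  let A := 2 * C ^ 2 + 1
  let K := 2 * (2 * ρ) + 4 * (2 * ρ) * (2 * ρ + 1)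
  let Q := 1 + 2 * bracketMass (2 * ρ)
  have hQ : 0 < Q := by linarith [bracketMass_nonneg (2 * ρ)]
  refine ⟨max (1 + 2 * K) (18 * A + 1) * Q / 2, fun V W hV hW u hu heq lam hlam hfin => ?_⟩
  let μ := 2 * lam / Q
  have hμQ : μ * Q = 2 * lam := div_mul_cancel₀ _ hQ.ne'
  obtain ⟨hμK, hμA⟩ : 1 + 2 * K ≤ μ ∧ 18 * A + 1 ≤ μ := by
    refine max_le_iff.1 ((le_div_iff₀ hQ).2 ?_)
    linarith
  have hμ : 0 ≤ μ := by linarith [sq_nonneg C]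
  have hderivs := hu.hasSecondWeakDerivs dir
  refine hderivs.ae_eq_zero (coordX_dir_self j) (fun i hi => coordX_dir_of_ne j hi)
    (isCarlemanWeight_weightExponent hσ hμK) (weightSlope_le hσ)
    (fun r => deriv_weightSlope (2 * ρ) ▸ bracket_pos _ r) (A := A) (by positivity) hμA ?_
    fun R hR => setIntegral_closedBall_weight_le hσ hμ hμQ j
      hderivs.memL2loc.locallyIntegrable.aestronglyMeasurable hfin (zero_le_one.trans hR)
  filter_upwards [hV, hW, heq] with z hv hw h
  rw [deriv_weightSlope]
  refine (norm_sq_sum_weakDeriv_le_bracket hv hw h).trans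
    (mul_le_mul_of_nonneg_right (lt_add_one _).le ?_)
  have := bracket_pos (2 * ρ) (z.2 j)
  positivity

open Waveguide in
theorem theorem1 (n : ℕ) (hn : 1 ≤ n) (ρ : ℝ) (hρ : 1 / 4 < ρ) (C : ℝ) (hC : 0 < C) :
    ∃ lam₀ : ℝ,
      ∀ (V : SpaceTime n → ℂ) (W : SpaceTime n → Covec n),
        MemLp V ⊤ volume →
        (∀ᵐ z : SpaceTime n, ‖V z‖ ≤ C / (1 + ‖z.2‖ ^ 2) ^ ρ) →
        MemLp W ⊤ volume →
        (∀ᵐ z : SpaceTime n, ‖W z‖ ≤ C / (1 + ‖z.2‖ ^ 2) ^ ρ) →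
        ∀ u : SpaceTime n → ℂ,
          IsC1H1 u → MemHloc 2 u →
          (∀ᵐ z : SpaceTime n, ‖laplaceTX u z‖ ≤ ‖V z * u z‖ + ‖firstOrder W u z‖) →
          ∀ lam : ℝ, lam₀ < lam →
            (⨆ t : ℝ, ∫⁻ x : Space n,
              ENNReal.ofReal (Real.exp (4 * lam * ‖x‖) * ‖u (t, x)‖ ^ 2)) < ⊤ →
            u =ᵐ[volume] 0 ∧ ∀ t : ℝ, (fun x => u (t, x)) =ᵐ[volume] 0 := by
  let j : Fin n := ⟨0, hn⟩
  obtain ⟨lam₀, hlam₀⟩ := theorem1_general j hρ C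
  refine ⟨max lam₀ 0, fun V W _ hV _ hW u huC huH heq lam hlam hfin => ?_⟩
  have hcoord (z : SpaceTime n) := div_rpow_norm_le_coord hC.le (by linarith : 0 ≤ ρ) z.2 j
  have hlam_nonneg : 0 ≤ 4 * lam := by linarith [le_max_right lam₀ 0]
  have hu : u =ᵐ[volume] 0 :=
    hlam₀ V W (hV.mono fun z hz => hz.trans (hcoord z)) (hW.mono fun z hz => hz.trans (hcoord z))
      u huH heq lam ((le_max_left _ _).trans_lt hlam)
      ((iSup_lintegral_exp_coord_le hlam_nonneg j u).trans_lt hfin)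
  exact ⟨hu, huC.slice_ae_eq_zero hu⟩
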